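/- Let $N\ge 1$ be an integer, $\lambda>0$ and $T>0$, and let $$g_\lambda(x,t,y)=\Big(\frac{\lambda}{2\pi\sinh(\lambda t)}\Big)^{N/2}\exp\Big[-\frac{\lambda\big(\cosh(\lambda t)(|x|^2+|y|^2)-2(x,y)\big)}{2\sinh(\lambda t)}\Big],\qquad x,y\in\mathbb R^N,\ t\in(0,T],$$ be Mehler's kernel, the Green function of $\partial_t u=\frac12\Delta u-\frac{\lambda^2}{2}|x|^2u$. Let the initial datum be the measure $\varphi_0=e^{N\lambda T/4}\,\delta_0$ and the final datum the measure $d\psi_T(y)=e^{N\lambda T/4}e^{-\lambda|y|^2/2}\,dy$ on $\mathbb R^N$. Let $(Z_t)_{t\in[0,T]}$ be an $\mathbb R^N$-valued Bernstein process associated with these data on a probability space $(\Omega,\mathcal F,\mathbb P)$, that is: (i) for all $0\le s<r<t\le T$ and every bounded Borel function $f:\mathbb R^N\to\mathbb R$, almost surely $\mathbb E(f(Z_r)\mid Z_\tau,\ \tau\in[0,s]\cup[t,T])=\mathbb E(f(Z_r)\mid Z_s,Z_t)$; (ii) for all $0\le s<r<t\le T$ and every Borel set $E\subset\mathbb R^N$,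 almost surely $$\mathbb P(Z_r\in E\mid Z_s,Z_t)=\int_E\frac{g_\lambda(Z_t,t-r,z)\,g_\lambda(z,r-s,Z_s)}{g_\lambda(Z_t,t-s,Z_s)}\,dz;$$ (iii) the joint law of $(Z_0,Z_T)$ is $g_\lambda(x,T,y)\,d\varphi_0(x)\,d\psi_T(y)$. Then $(Z_t)_{t\in[0,T]}$ is a Gaussian and Markovian process. For every $t\in(0,T]$ and every Borel set $E\subset\mathbb R^N$, $$\mathbb P(Z_t\in E)=(2\pi\sigma_\lambda(t))^{-N/2}\int_E\exp\Big[-\frac{|x|^2}{2\sigma_\lambda(t)}\Big]dx,\qquad \sigma_\lambda(t)=\frac{\sinh(\lambda t)\,e^{-\lambda t}}{\lambda}.$$ Furthermore $\mathbb P(Z_0=0)=1$, and for all $s,t\in[0,T]$ and $i,j\in\{1,\dots,N\}$ the product $Z_s^iZ_t^j$ is integrable with $$\mathbb E(Z_s^iZ_t^j)=\frac{e^{-\lambda(t+s)}}{2\lambda}\big(e^{2\lambda(t\wedge s)}-1\big)\,\delta_{ij}.$$ Finally, $(Z_t)_{t\in[0,T]}$ has the same law as a process $(X_t)_{t\in[0,T]}$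 (on some probability space) whose components $X^1,\dots,X^N$ are independent, non-stationary, one-dimensional Ornstein–Uhlenbeck processes started at the origin, that is, each $X^i$ has almost surely continuous paths and solves $dX^i_t=-\lambda X^i_t\,dt+dW^i_t$, $X^i_0=0$, for some one-dimensional Wiener process $W^i$. -/

import Mathlib

open MeasureTheory ProbabilityTheory
open scoped NNReal ENNReal

noncomputable section

namespace BernsteinOU

/-! Processes on the time interval `[0, T]` are written as functions `Z : ℝ → Ω → E`; only their
values at times in `Set.Icc 0 T` ever matter. -/

/-- The state space `ℝ^N` with its Euclidean norm. -/
abbrev Space (N : ℕ) : Type := EuclideanSpace ℝ (Fin N)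

section Processes

variable {Ω E : Type*} [MeasurableSpace E]

/-- The `σ`-algebra generated by `Z τ`, `0 ≤ τ ≤ s`. -/
abbrev pastSigma (Z : ℝ → Ω → E) (s : ℝ) : MeasurableSpace Ω :=
  ⨆ τ ∈ Set.Icc (0 : ℝ) s, MeasurableSpace.comap (Z τ) inferInstance

/-- The `σ`-algebra generated by `Z τ`, `t ≤ τ ≤ T`. -/
abbrev futureSigma (T : ℝ) (Z : ℝ → Ω → E) (t : ℝ) : MeasurableSpace Ω :=
  ⨆ τ ∈ Set.Icc t T, MeasurableSpace.comap (Z τ) inferInstance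

/-- The `σ`-algebra generated by `Z s`. -/
abbrev sigmaAt (Z : ℝ → Ω → E) (s : ℝ) : MeasurableSpace Ω :=
  MeasurableSpace.comap (Z s) inferInstance

variable [MeasurableSpace Ω]

/-- `Z` is a Bernstein (reciprocal) process on `[0, T]`: its values are random variables, and
`E(f(Z_r) | past of s ∨ future of t) = E(f(Z_r) | Z_s, Z_t)` almost surely for every bounded Borel
function `f` and all `r ∈ (s, t) ⊂ [0, T]`. -/
structure IsBernstein (T : ℝ) (Z : ℝ → Ω → E) (P : Measure Ω) : Prop where
  measurable : ∀ t ∈ Set.Icc (0 : ℝ) T, Measurable (Z t)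
  condExp_eq : ∀ f : E → ℝ, Measurable f → (∃ C : ℝ, ∀ x, |f x| ≤ C) →
    ∀ s r t : ℝ, 0 ≤ s → s < r → r < t → t ≤ T →
      P[fun ω => f (Z r ω) | pastSigma Z s ⊔ futureSigma T Z t]
        =ᵐ[P] P[fun ω => f (Z r ω) | sigmaAt Z s ⊔ sigmaAt Z t]

/-- `Z` is a Markov process on `[0, T]` (with respect to its own past). -/
structure IsMarkovian (T : ℝ) (Z : ℝ → Ω → E) (P : Measure Ω) : Prop where
  measurable : ∀ t ∈ Set.Icc (0 : ℝ) T, Measurable (Z t)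
  condExp_eq : ∀ f : E → ℝ, Measurable f → (∃ C : ℝ, ∀ x, |f x| ≤ C) →
    ∀ s t : ℝ, 0 ≤ s → s ≤ t → t ≤ T →
      P[fun ω => f (Z t ω) | pastSigma Z s] =ᵐ[P] P[fun ω => f (Z t ω) | sigmaAt Z s]

/-- `Z` is stationary on `[0, T]`: its finite-dimensional laws are invariant under those time
shifts that keep all the times involved in `[0, T]`. -/
def IsStationaryOn (T : ℝ) (Z : ℝ → Ω → E) (P : Measure Ω) : Prop :=
  ∀ (n : ℕ) (t : Fin n → ℝ) (h : ℝ),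
    (∀ k, t k ∈ Set.Icc (0 : ℝ) T) → (∀ k, t k + h ∈ Set.Icc (0 : ℝ) T) →
      P.map (fun ω k => Z (t k + h) ω) = P.map (fun ω k => Z (t k) ω)

end Processes

section BernsteinData

variable {N : ℕ}

/-- The density `p(x, t; z, r; y, s) = g(x, t-r, z) g(z, r-s, y) / g(x, t-s, y)` built from a
kernel `g`. -/
def bernsteinDensity (g : Space N → ℝ → Space N → ℝ)
    (x : Space N) (t : ℝ) (z : Space N) (r : ℝ) (y : Space N) (s : ℝ) : ℝ :=
  g x (t - r) z * g z (r - s) y / g x (t - s) y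

/-- The transition function `P(x, t; E, r; y, s) = ∫_E p(x, t; z, r; y, s) dz`. -/
def bernsteinTransition (g : Space N → ℝ → Space N → ℝ)
    (x : Space N) (t : ℝ) (A : Set (Space N)) (r : ℝ) (y : Space N) (s : ℝ) : ℝ :=
  ∫ z in A, bernsteinDensity g x t z r y s

/-- The measure `μ(F) = ∫_F g(x, T, y) d(φ₀ ⊗ ψ_T)(x, y)` on `ℝ^N × ℝ^N`. -/
def markovianMeasure (g : Space N → ℝ → Space N → ℝ) (T : ℝ) (φ₀ ψT : Measure (Space N)) :
    Measure (Space N × Space N) :=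
  (φ₀.prod ψT).withDensity (fun q => ENNReal.ofReal (g q.1 T q.2))

/-- `Z` is a Bernstein process on `[0, T]` associated with the Green function `g`, the initial
datum `φ₀` and the final datum `ψT`: its transition function is the one built from `g`, and the
joint law of `(Z_0, Z_T)` is `g(x, T, y) d(φ₀ ⊗ ψT)(x, y)`. -/
structure IsAssociatedBernstein {Ω : Type*} [MeasurableSpace Ω]
    (g : Space N → ℝ → Space N → ℝ) (T : ℝ) (φ₀ ψT : Measure (Space N))
    (Z : ℝ → Ω → Space N) (P : Measure Ω) : Prop where
  isBernstein : IsBernstein T Z P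
  transition : ∀ A : Set (Space N), MeasurableSet A →
    ∀ s r t : ℝ, 0 ≤ s → s < r → r < t → t ≤ T →
      P[(Z r ⁻¹' A).indicator (fun _ => (1 : ℝ)) | sigmaAt Z s ⊔ sigmaAt Z t]
        =ᵐ[P] fun ω => bernsteinTransition g (Z t ω) t A r (Z s ω) s
  endpoints : P.map (fun ω => (Z 0 ω, Z T ω)) = markovianMeasure g T φ₀ ψT

/-- The `N`-dimensional Mehler kernel, which is the Green function of
`∂_t u = ½ Δ u - (lam² / 2) |x|² u`. -/
def mehlerKernel (N : ℕ) (lam : ℝ) (x : Space N) (t : ℝ) (y : Space N) : ℝ :=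
  (lam / (2 * Real.pi * Real.sinh (lam * t))) ^ ((N : ℝ) / 2) *
    Real.exp (-(lam * (Real.cosh (lam * t) * (‖x‖ ^ 2 + ‖y‖ ^ 2) - 2 * inner ℝ x y)
      / (2 * Real.sinh (lam * t))))

/-- The initial datum `(e^{lam T})^{N/4} δ`. -/
def diracDatum (N : ℕ) (lam T : ℝ) : Measure (Space N) :=
  ENNReal.ofReal (Real.exp (lam * T) ^ ((N : ℝ) / 4)) • Measure.dirac 0

/-- The final datum with Lebesgue density `(e^{lam T})^{N/4} e^{-lam |x|² / 2}`. -/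
def gaussianDatum (N : ℕ) (lam T : ℝ) : Measure (Space N) :=
  (volume : Measure (Space N)).withDensity fun x =>
    ENNReal.ofReal (Real.exp (lam * T) ^ ((N : ℝ) / 4) * Real.exp (-(lam * ‖x‖ ^ 2 / 2)))

end BernsteinData

/-- The real process `X` is, on `[0, T]`, an Ornstein-Uhlenbeck process with parameter `lam` started
at the origin: the solution, with almost surely continuous paths, of
`dX_t = -lam X_t dt + dW_t`, `X_0 = 0`, for some Wiener process `W`. -/
def IsOrnsteinUhlenbeckFromZero {Ω : Type*} [MeasurableSpace Ω] (lam T : ℝ)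
    (X : ℝ → Ω → ℝ) (P : Measure Ω) : Prop :=
  ∃ W : ℝ≥0 → Ω → ℝ, IsBrownianReal W P ∧
    ∀ᵐ ω ∂P, ContinuousOn (fun t => X t ω) (Set.Icc 0 T) ∧ X 0 ω = 0 ∧
      ∀ t ∈ Set.Icc (0 : ℝ) T, X t ω = -lam * (∫ τ in (0 : ℝ)..t, X τ ω) + W t.toNNReal ω

end BernsteinOU

end

/-! Taking the later conditioning time equal to `T` turns the two-sided Bernstein property into
conditioning on the past up to `s` together with the single variable `Z T`. For Mehler's kernel the
transition density is Gaussian: completing the square gives a mean linear in `Z s` and `Z T`, and a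
variance that depends on the times only (`bernsteinDensity_mehlerKernel`). Hence `Z r` minus this
mean, the `innovation`, is an isotropic Gaussian vector independent of that past and of `Z T`
(`innovation_law_and_indep`). The boundary data force `Z 0 = 0` almost surely and make `Z T`
Gaussian. Adding interior times in increasing order, each through one independent innovation, makes
every finite-dimensional law Gaussian (`hasGaussianLaw_insert`); the same decomposition yields the
covariance (`covariance_eq`).

Mean and covariance determine a Gaussian law, so the rest follows from the covariance. For `s ≤ t`
it factorises as `sinh(lam s) e^{-lam t} / lam`; therefore `Z t - e^{-lam (t - s)} Z s` is
uncorrelated with the past of `s`, hence independent of it, which is the Markov property.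

The comparison process is built from independent standard normals. Their Schauder series is a
Brownian bridge `B`, whose covariance comes from the self-similarity `bridgeCov_eq`. Then `(1 + τ)
B(τ / (1 + τ))` has the covariance of a Brownian motion in `τ`; running it with the clock `ouClock`
and damping it by `e^{-lam t}` gives `ouProcess`. The noise is defined as `X_t + lam ∫ X`, so that
the stochastic equation holds by construction. It remains to see that this noise is a Brownian
motion (`isBrownianReal_ouNoise`): it is continuous, Gaussian as a limit of Riemann sums, and has
covariance `min s t`. -/

/-! ### Gaussian processes: almost sure limits and determination by the covariance. -/

open Filter Topology in
/-- Almost sure limits of centered real Gaussian variables are centered Gaussian, and the variances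
converge. -/
theorem exists_map_eq_gaussianReal_of_ae_tendsto {Ω : Type*} {mΩ : MeasurableSpace Ω}
    {P : Measure Ω} [IsProbabilityMeasure P] {Y : ℕ → Ω → ℝ} {Z : Ω → ℝ} {v : ℕ → ℝ≥0}
    (hY : ∀ n, AEMeasurable (Y n) P) (hlaw : ∀ n, P.map (Y n) = gaussianReal 0 (v n))
    (hlim : ∀ᵐ ω ∂P, Tendsto (fun n => Y n ω) atTop (𝓝 (Z ω))) :
    ∃ w : ℝ≥0, Tendsto v atTop (𝓝 w) ∧ P.map Z = gaussianReal 0 w := by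
  have hZ : AEMeasurable Z P := aemeasurable_of_tendsto_metrizable_ae atTop hY hlim
  have hPZ : IsProbabilityMeasure (P.map Z) := Measure.isProbabilityMeasure_map hZ
  have hchar : ∀ u : ℝ, Tendsto (fun n => Complex.exp (-((v n : ℝ) * u ^ 2 / 2 : ℝ))) atTop
      (𝓝 (charFun (P.map Z) u)) := by
    intro u
    have h1 : ∀ n, Complex.exp (-((v n : ℝ) * u ^ 2 / 2 : ℝ)) =
        ∫ ω, Complex.exp (u * Y n ω * Complex.I) ∂P := by
      intro n
      have := charFun_gaussianReal (μ := 0) (v := v n) u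
      rw [← hlaw n, charFun_apply_real, integral_map (hY n) (by fun_prop)] at this
      rw [this]
      congr 1
      push_cast
      ring
    simp_rw [h1]
    rw [charFun_apply_real, integral_map hZ (by fun_prop)]
    refine tendsto_integral_of_dominated_convergence (fun _ => 1) (fun n => ?_)
      (integrable_const _) (fun n => ?_) ?_
    · have := hY n
      exact AEMeasurable.aestronglyMeasurable (by fun_prop)
    · refine .of_forall fun ω => ?_
      rw [← Complex.ofReal_mul, Complex.norm_exp_ofReal_mul_I]
    · filter_upwards [hlim] with ω hω
      have : Continuous fun x : ℝ => Complex.exp (u * x * Complex.I) := by fun_prop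
      exact (this.tendsto _).comp hω
  have hre : ∀ u : ℝ, Tendsto (fun n => Real.exp (-((v n : ℝ) * u ^ 2 / 2))) atTop
      (𝓝 (charFun (P.map Z) u).re) := by
    intro u
    refine ((Complex.continuous_re.tendsto _).comp (hchar u)).congr fun n => ?_
    simp only [Function.comp]
    rw [← Complex.ofReal_neg, Complex.exp_ofReal_re]
  -- A single nonzero frequency with positive limit suffices to recover the variances by a
  -- logarithm. It exists because the limiting characteristic function is continuous and equals 1 at
  -- 0.
  obtain ⟨u, hu0, hu⟩ : ∃ u : ℝ, u ≠ 0 ∧ 0 < (charFun (P.map Z) u).re := by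
    have hc : Continuous fun u : ℝ => (charFun (P.map Z) u).re :=
      Complex.continuous_re.comp continuous_charFun
    have h0 : 0 < (charFun (P.map Z) (0 : ℝ)).re := by simp
    have : ∀ᶠ u in 𝓝[≠] (0 : ℝ), 0 < (charFun (P.map Z) u).re :=
      (hc.continuousAt.eventually (lt_mem_nhds h0)).filter_mono nhdsWithin_le_nhds
    obtain ⟨u, h1, h2⟩ := (this.and self_mem_nhdsWithin).exists
    exact ⟨u, h2, h1⟩
  have hv : Tendsto (fun n => (v n : ℝ)) atTop
      (𝓝 (-2 / u ^ 2 * Real.log (charFun (P.map Z) u).re)) := by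
    have := ((Real.continuousAt_log hu.ne').tendsto.comp (hre u)).const_mul (-2 / u ^ 2)
    refine this.congr fun n => ?_
    simp only [Function.comp, Real.log_exp]
    field_simp
  lift -2 / u ^ 2 * Real.log (charFun (P.map Z) u).re to ℝ≥0
    using ge_of_tendsto' hv fun n => (v n).2 with w
  refine ⟨w, NNReal.tendsto_coe.1 hv, Measure.ext_of_charFun ?_⟩
  ext x
  rw [charFun_gaussianReal]
  refine tendsto_nhds_unique (hchar x) ?_
  have hcont : Continuous fun y : ℝ => Complex.exp (-(y * x ^ 2 / 2 : ℝ)) := by fun_prop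
  have hval : Complex.exp (x * (0 : ℝ) * Complex.I - w * x ^ 2 / 2) =
      Complex.exp (-((w : ℝ) * x ^ 2 / 2 : ℝ)) := by
    push_cast
    simp
  rw [hval]
  exact (hcont.tendsto _).comp hv

theorem ProbabilityTheory.HasGaussianLaw.map_eq_of_integral_eq_zero {Ω : Type*} {mΩ : MeasurableSpace Ω}
    {P : Measure Ω} {Y : Ω → ℝ} (hY : HasGaussianLaw Y P) (h0 : P[Y] = 0) :
    P.map Y = gaussianReal 0 Var[Y; P].toNNReal := by
  rw [hY.map_eq_gaussianReal, h0]

/-- The limit, pointwise in time and almost surely, of centered Gaussian processes is a centered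
Gaussian process, and the covariances converge. -/
theorem ProbabilityTheory.IsGaussianProcess.of_ae_tendsto {Ω S : Type*} {mΩ : MeasurableSpace Ω}
    {P : Measure Ω} [IsProbabilityMeasure P] {X : ℕ → S → Ω → ℝ} {Y : S → Ω → ℝ}
    (hX : ∀ n, IsGaussianProcess (X n) P) (h0 : ∀ n t, P[X n t] = 0)
    (hlim : ∀ t, ∀ᵐ ω ∂P, Filter.Tendsto (fun n => X n t ω) Filter.atTop (nhds (Y t ω))) :
    IsGaussianProcess Y P ∧ (∀ t, P[Y t] = 0) ∧
      ∀ s t, Filter.Tendsto (fun n => cov[X n s, X n t; P]) Filter.atTop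
        (nhds cov[Y s, Y t; P]) := by
  have hYm : ∀ t, AEMeasurable (Y t) P := fun t =>
    aemeasurable_of_tendsto_metrizable_ae Filter.atTop (fun n => (hX n).aemeasurable t) (hlim t)
  have hY : IsGaussianProcess Y P := by
    refine ⟨fun I => ⟨isGaussian_of_map_eq_gaussianReal fun L => ?_⟩⟩
    have hg : ∀ n, HasGaussianLaw (fun ω => L (I.restrict (X n · ω))) P := fun n =>
      ((hX n).hasGaussianLaw I).map_fun L
    have h0' : ∀ n, ∫ ω, L (I.restrict (X n · ω)) ∂P = 0 := by
      intro n
      rw [L.integral_comp_comm ((hX n).hasGaussianLaw I).integrable]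
      have : ∫ ω, I.restrict (X n · ω) ∂P = 0 := by
        ext i
        refine (eval_integral (μ := P) (f := fun ω (j : I) => X n j ω)
          (fun j => ((hX n).hasGaussianLaw_eval j).integrable) i).trans (h0 n i)
      rw [this, map_zero]
    obtain ⟨w, -, hw⟩ := exists_map_eq_gaussianReal_of_ae_tendsto
      (fun n => (hg n).aemeasurable) (fun n => (hg n).map_eq_of_integral_eq_zero (h0' n))
      (Z := fun ω => L (I.restrict (Y · ω))) (by
        have : ∀ᵐ ω ∂P, ∀ t : I, Filter.Tendsto (fun n => X n t ω) Filter.atTop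
            (nhds (Y t ω)) := ae_all_iff.2 fun t => hlim t
        filter_upwards [this] with ω hω
        exact (L.continuous.tendsto _).comp (tendsto_pi_nhds.2 hω))
    refine ⟨0, w, ?_⟩
    rw [AEMeasurable.map_map_of_aemeasurable (f := fun ω => I.restrict (Y · ω))
      L.continuous.aemeasurable (aemeasurable_pi_lambda _ fun t => hYm t)]
    exact hw
  -- Only `c = 0` and `c = 1` are used: they give the variances of single variables and of sums,
  -- from which polarization recovers the covariance.
  have hvar : ∀ (c : ℝ) s t, P[fun ω => c * Y s ω + Y t ω] = 0 ∧
      Filter.Tendsto (fun n => Var[fun ω => c * X n s ω + X n t ω; P]) Filter.atTop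
        (nhds Var[fun ω => c * Y s ω + Y t ω; P]) := by
    intro c s t
    have hg : ∀ n, HasGaussianLaw (fun ω => c * X n s ω + X n t ω) P := fun n =>
      (hX n).hasGaussianLaw_prodMk.map_fun
        (c • ContinuousLinearMap.fst ℝ ℝ ℝ + ContinuousLinearMap.snd ℝ ℝ ℝ)
    have h0' : ∀ n, ∫ ω, c * X n s ω + X n t ω ∂P = 0 := by
      intro n
      rw [integral_add (((hX n).hasGaussianLaw_eval s).integrable.const_mul c)
        ((hX n).hasGaussianLaw_eval t).integrable, integral_const_mul, h0, h0]
      simp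
    obtain ⟨w, hv, hw⟩ := exists_map_eq_gaussianReal_of_ae_tendsto
      (fun n => (hg n).aemeasurable) (fun n => (hg n).map_eq_of_integral_eq_zero (h0' n))
      (Z := fun ω => c * Y s ω + Y t ω) (by
        filter_upwards [hlim s, hlim t] with ω h1 h2
        exact (h1.const_mul c).add h2)
    have hlaw : HasLaw (fun ω => c * Y s ω + Y t ω) (gaussianReal 0 w) P :=
      ⟨by have := hYm s; have := hYm t; fun_prop, hw⟩
    refine ⟨?_, ?_⟩
    · rw [hlaw.integral_eq, integral_id_gaussianReal]
    · rw [hlaw.variance_eq, variance_id_gaussianReal]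
      refine (NNReal.tendsto_coe.2 hv).congr fun n => ?_
      rw [Real.coe_toNNReal _ (variance_nonneg _ _)]
  refine ⟨hY, fun t => by simpa using (hvar 0 t t).1, fun s t => ?_⟩
  have hpol : ∀ {A B : Ω → ℝ}, MemLp A 2 P → MemLp B 2 P →
      cov[A, B; P] = (Var[fun ω => 1 * A ω + B ω; P] - Var[fun ω => 0 * A ω + A ω; P]
        - Var[fun ω => 0 * B ω + B ω; P]) / 2 := by
    intro A B hA hB
    have := variance_fun_add hA hB
    simp only [one_mul, zero_mul, zero_add]
    linarith
  rw [hpol (hY.hasGaussianLaw_eval s).memLp_two (hY.hasGaussianLaw_eval t).memLp_two]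
  refine Filter.Tendsto.congr (fun n => (hpol ((hX n).hasGaussianLaw_eval s).memLp_two
    ((hX n).hasGaussianLaw_eval t).memLp_two).symm) ?_
  exact (((hvar 1 s t).2.sub (hvar 0 s s).2).sub (hvar 0 t t).2).div_const 2

/-- Two centered real Gaussian processes with the same covariance have the same law. -/
theorem ProbabilityTheory.IsGaussianProcess.map_eq_of_covariance_eq {Ω Ω' S : Type*}
    {mΩ : MeasurableSpace Ω} {mΩ' : MeasurableSpace Ω'} {P : Measure Ω} {P' : Measure Ω'}
    {X : S → Ω → ℝ} {Y : S → Ω' → ℝ} (hX : IsGaussianProcess X P) (hY : IsGaussianProcess Y P')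
    (mX : ∀ t, Measurable (X t)) (mY : ∀ t, Measurable (Y t))
    (hX0 : ∀ t, P[X t] = 0) (hY0 : ∀ t, P'[Y t] = 0)
    (hcov : ∀ s t, cov[X s, X t; P] = cov[Y s, Y t; P']) :
    P.map (fun ω t => X t ω) = P'.map (fun ω t => Y t ω) := by
  have := hX.isProbabilityMeasure
  have := hY.isProbabilityMeasure
  have key : ∀ I : Finset S, P.map (fun ω => I.restrict (X · ω)) =
      P'.map (fun ω => I.restrict (Y · ω)) := by
    intro I
    have := (hX.hasGaussianLaw I).isGaussian_map
    have := (hY.hasGaussianLaw I).isGaussian_map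
    classical
    have hL : ∀ (L : StrongDual ℝ (I → ℝ)) (x : I → ℝ), L x = ∑ i, L (Pi.single i 1) * x i := by
      intro L x
      conv_lhs => rw [← Finset.univ_sum_single x, map_sum]
      refine Finset.sum_congr rfl fun i _ => ?_
      rw [show Pi.single i (x i) = x i • (Pi.single i 1 : I → ℝ) by
        rw [← Pi.single_smul, smul_eq_mul, mul_one], map_smul, smul_eq_mul, mul_comm]
    refine Measure.ext_of_charFunDual ?_
    ext L
    rw [(hX.hasGaussianLaw I).charFunDual_map_eq_fun, (hY.hasGaussianLaw I).charFunDual_map_eq_fun]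
    rw [funext fun ω => hL L (I.restrict (X · ω)), funext fun ω => hL L (I.restrict (Y · ω))]
    simp only [Finset.restrict]
    have mX2 : ∀ i : I, MemLp (fun ω => L (Pi.single i 1) * X i ω) 2 P := fun i =>
      (hX.hasGaussianLaw_eval i.1).memLp_two.const_mul _
    have mY2 : ∀ i : I, MemLp (fun ω => L (Pi.single i 1) * Y i ω) 2 P' := fun i =>
      (hY.hasGaussianLaw_eval i.1).memLp_two.const_mul _
    rw [integral_finsetSum _ fun i _ => (mX2 i).integrable one_le_two,
      integral_finsetSum _ fun i _ => (mY2 i).integrable one_le_two,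
      variance_fun_sum mX2, variance_fun_sum mY2]
    simp only [integral_const_mul, hX0, hY0, covariance_const_mul_left,
      covariance_const_mul_right, hcov]
  -- Both laws are projective limits of the same family of finite-dimensional laws, and such a limit
  -- is unique.
  have hP := isProjectiveLimit_map (P := P) (X := X)
    (measurable_pi_lambda _ mX).aemeasurable
  have hP' := isProjectiveLimit_map (P := P') (X := Y)
    (measurable_pi_lambda _ mY).aemeasurable
  simp_rw [key] at hP
  exact hP.unique hP'

/-! ### Conditional laws and independence. -/

/-- If, conditionally on `m`, the variable `Z` has law `V + ν` for an `m`-measurable `V`, then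
`Z - V` has law `ν` and is independent of `m`. -/
theorem indep_sub_of_condExp_indicator_eq {Ω E : Type*} {m mΩ : MeasurableSpace Ω}
    {P : Measure Ω} [IsProbabilityMeasure P] [AddCommGroup E] [MeasurableSpace E] [MeasurableAdd₂ E]
    [MeasurableSub₂ E] (hm : m ≤ mΩ) {Z V : Ω → E} (hZ : Measurable Z) (hV : Measurable[m] V)
    {ν : Measure E} [IsProbabilityMeasure ν]
    (h : ∀ A : Set E, MeasurableSet A → P[(Z ⁻¹' A).indicator (fun _ => (1 : ℝ)) | m]
      =ᵐ[P] fun ω => ν.real ((fun x => V ω + x) ⁻¹' A)) :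
    P.map (fun ω => Z ω - V ω) = ν ∧
      Indep (MeasurableSpace.comap (fun ω => Z ω - V ω) inferInstance) m P := by
  have hV' : Measurable V := hV.mono hm le_rfl
  have hrect : ∀ S, MeasurableSet[m] S → ∀ A : Set E, MeasurableSet A →
      P (Z ⁻¹' A ∩ S) = ∫⁻ ω in S, ν ((fun x => V ω + x) ⁻¹' A) ∂P := by
    intro S hS A hA
    have hmeas : Measurable fun ω => ν ((fun x => V ω + x) ⁻¹' A) := by
      have : MeasurableSet {p : Ω × E | V p.1 + p.2 ∈ A} :=
        (hV'.comp measurable_fst).add measurable_snd hA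
      exact measurable_measure_prodMk_left this
    have h1 : ∫ ω in S, (Z ⁻¹' A).indicator (fun _ => (1 : ℝ)) ω ∂P =
        ∫ ω in S, ν.real ((fun x => V ω + x) ⁻¹' A) ∂P := by
      rw [← setIntegral_condExp hm ((integrable_const _).indicator (hZ hA)) hS]
      exact setIntegral_congr_ae (hm _ hS) ((h A hA).mono fun ω hω _ => hω)
    rw [integral_indicator_const _ (hZ hA), smul_eq_mul, mul_one,
      measureReal_restrict_apply (hZ hA)] at h1
    rw [← ENNReal.ofReal_toReal (measure_ne_top P (Z ⁻¹' A ∩ S))]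
    rw [measureReal_def] at h1
    rw [h1, ofReal_integral_eq_lintegral_ofReal _ (.of_forall fun _ => measureReal_nonneg)]
    · simp
    · refine Integrable.of_bound (C := 1) ?_ (.of_forall fun ω => ?_)
      · exact hmeas.ennreal_toReal.aestronglyMeasurable
      · rw [Real.norm_of_nonneg measureReal_nonneg]
        exact measureReal_le_one
  -- On every event `S` of `m`, the pair `(V, Z)` is the image of a product measure under the shear
  -- `(v, x) ↦ (v, v + x)`. Undoing the shear gives `Z - V` the law `P S • ν` on `S`: `S = univ`
  -- identifies the law, and general `S` gives the independence.
  have hjoint : ∀ S, MeasurableSet[m] S →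
      (P.restrict S).map (fun ω => (V ω, Z ω)) =
        (((P.restrict S).map V).prod ν).map (fun q => (q.1, q.1 + q.2)) := by
    intro S hS
    refine Measure.ext_prod fun {C A} hC hA => ?_
    rw [Measure.map_apply (by fun_prop) (hC.prod hA), Measure.map_apply (by fun_prop) (hC.prod hA),
      Measure.prod_apply ((by fun_prop : Measurable fun q : E × E => (q.1, q.1 + q.2))
        (hC.prod hA)), lintegral_map _ hV']
    · have e1 : (fun ω => (V ω, Z ω)) ⁻¹' C ×ˢ A = Z ⁻¹' A ∩ V ⁻¹' C := by
        ext ω; simp [and_comm]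
      have e2 : ∀ ω, ν (Prod.mk (V ω) ⁻¹' ((fun q : E × E => (q.1, q.1 + q.2)) ⁻¹' C ×ˢ A)) =
          (V ⁻¹' C).indicator (fun ω => ν ((fun x => V ω + x) ⁻¹' A)) ω := by
        intro ω
        by_cases hω : V ω ∈ C
        · rw [Set.indicator_of_mem (by exact hω)]
          congr 1
          ext x
          simp [hω]
        · rw [Set.indicator_of_notMem (by exact hω)]
          convert measure_empty (μ := ν)
          ext x
          simp [hω]
      simp_rw [e2]
      rw [e1, lintegral_indicator (hV' hC), Measure.restrict_restrict (hV' hC),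
        Measure.restrict_apply ((hZ hA).inter (hV' hC)), Set.inter_assoc,
        hrect _ ((hV hC).inter hS) A hA]
    · exact measurable_measure_prodMk_left
        ((by fun_prop : Measurable fun q : E × E => (q.1, q.1 + q.2)) (hC.prod hA))
  have hfin : ∀ S, MeasurableSet[m] S →
      (P.restrict S).map (fun ω => Z ω - V ω) = P S • ν := by
    intro S hS
    have := congrArg (Measure.map fun q : E × E => q.2 - q.1) (hjoint S hS)
    rw [Measure.map_map (by fun_prop) (by fun_prop),
      Measure.map_map (by fun_prop) (by fun_prop)] at this
    have e : (fun q : E × E => q.2 - q.1) ∘ (fun q : E × E => (q.1, q.1 + q.2)) = Prod.snd := by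
      ext q; simp
    rw [e, Measure.map_snd_prod, Measure.map_apply hV' .univ] at this
    simpa [Function.comp_def] using this
  have hlaw : P.map (fun ω => Z ω - V ω) = ν := by
    simpa using hfin Set.univ .univ
  refine ⟨hlaw, (Indep_iff _ _ _).2 ?_⟩
  rintro _ S ⟨B, hB, rfl⟩ hS
  have := congrArg (fun μ : Measure E => μ B) (hfin S hS)
  have hB' : MeasurableSet ((fun ω => Z ω - V ω) ⁻¹' B) := (hZ.sub hV') hB
  rw [Measure.map_apply (by fun_prop) hB, Measure.restrict_apply hB'] at this
  rw [this, ← Measure.map_apply (by fun_prop) hB, hlaw]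
  simp [mul_comm]

/-- The conditional expectation of a function of an `m`-measurable variable and a variable
independent of `m`. -/
theorem condExp_comp_prod_eq_of_indep {Ω E F : Type*} {m mΩ : MeasurableSpace Ω}
    {P : Measure Ω} [IsProbabilityMeasure P] [MeasurableSpace E] [MeasurableSpace F]
    (hm : m ≤ mΩ) {V : Ω → E} {ξ : Ω → F} (hV : Measurable[m] V) (hξ : Measurable ξ)
    (hind : Indep m (MeasurableSpace.comap ξ inferInstance) P) {f : E × F → ℝ} (hf : Measurable f)
    {C : ℝ} (hC : ∀ q, |f q| ≤ C) :
    P[fun ω => f (V ω, ξ ω) | m] =ᵐ[P] fun ω => ∫ x, f (V ω, x) ∂(P.map ξ) := by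
  have hV' : Measurable V := hV.mono hm le_rfl
  have : IsProbabilityMeasure (P.map ξ) := Measure.isProbabilityMeasure_map hξ.aemeasurable
  have hsm : StronglyMeasurable fun v => ∫ x, f (v, x) ∂(P.map ξ) :=
    hf.stronglyMeasurable.integral_prod_right'
  have hb : ∀ v, ‖∫ x, f (v, x) ∂(P.map ξ)‖ ≤ C := fun v => by
    refine (norm_integral_le_of_norm_le_const (.of_forall fun x => hC (v, x))).trans ?_
    simp
  have hint : Integrable (fun ω => f (V ω, ξ ω)) P :=
    .of_bound (hf.comp (hV'.prodMk hξ)).aestronglyMeasurable C (.of_forall fun ω => hC _)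
  symm
  refine ae_eq_condExp_of_forall_setIntegral_eq hm hint (fun S _ _ => ?_) (fun S hS _ => ?_) ?_
  · exact (Integrable.of_bound (hsm.comp_measurable hV').aestronglyMeasurable C
      (.of_forall fun ω => hb _)).integrableOn
  · have hS' := hm _ hS
    have hjoint : (P.restrict S).map (fun ω => (V ω, ξ ω)) =
        ((P.restrict S).map V).prod (P.map ξ) := by
      refine Measure.ext_prod fun {A B} hA hB => ?_
      rw [Measure.prod_prod, Measure.map_apply (by fun_prop) (hA.prod hB),
        Measure.map_apply hV' hA, Measure.map_apply hξ hB,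
        Measure.restrict_apply ((hV'.prodMk hξ) (hA.prod hB)), Measure.restrict_apply (hV' hA),
        ← (Indep_iff _ _ _).1 hind _ _ ((hV hA).inter hS) ⟨B, hB, rfl⟩]
      congr 1
      ext ω
      simp only [Set.mem_inter_iff, Set.mem_preimage, Set.mem_prod]
      tauto
    calc ∫ ω in S, ∫ x, f (V ω, x) ∂(P.map ξ) ∂P
        = ∫ v, ∫ x, f (v, x) ∂(P.map ξ) ∂((P.restrict S).map V) := by
          rw [integral_map hV'.aemeasurable hsm.aestronglyMeasurable]
      _ = ∫ q, f q ∂(((P.restrict S).map V).prod (P.map ξ)) := by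
          rw [integral_prod]
          exact .of_bound hf.aestronglyMeasurable C (.of_forall fun q => hC q)
      _ = ∫ ω in S, f (V ω, ξ ω) ∂P := by
          rw [← hjoint, integral_map (hV'.prodMk hξ).aemeasurable hf.aestronglyMeasurable]
  · exact (hsm.comp_measurable hV).aestronglyMeasurable

/-! ### Isotropic Gaussian measures. -/

namespace BernsteinOU

/-- The density of the centered Gaussian measure with covariance `v` times the identity. -/
noncomputable def isoGaussianPDF (N : ℕ) (v : ℝ) (x : Space N) : ℝ :=
  (2 * Real.pi * v) ^ (-((N : ℝ) / 2)) * Real.exp (-(‖x‖ ^ 2 / (2 * v)))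

/-- The centered Gaussian measure with covariance `v` times the identity. -/
noncomputable def isoGaussian (N : ℕ) (v : ℝ) : Measure (Space N) :=
  volume.withDensity fun x => ENNReal.ofReal (isoGaussianPDF N v x)

variable {N : ℕ} {v : ℝ}

@[fun_prop]
lemma continuous_isoGaussianPDF : Continuous (isoGaussianPDF N v) := by
  unfold isoGaussianPDF
  fun_prop

lemma isoGaussianPDF_pos (hv : 0 < v) (x : Space N) : 0 < isoGaussianPDF N v x := by
  unfold isoGaussianPDF
  positivity

lemma integral_isoGaussianPDF (hv : 0 < v) : ∫ x : Space N, isoGaussianPDF N v x = 1 := by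
  have h := GaussianFourier.integral_rexp_neg_mul_sq_norm (V := Space N) (b := 1 / (2 * v))
    (by positivity)
  have e : ∀ x : Space N, isoGaussianPDF N v x =
      (2 * Real.pi * v) ^ (-((N : ℝ) / 2)) * Real.exp (-(1 / (2 * v)) * ‖x‖ ^ 2) := by
    intro x
    unfold isoGaussianPDF
    congr 2
    field_simp
  simp_rw [e]
  rw [integral_const_mul, h, finrank_euclideanSpace, Fintype.card_fin,
    show Real.pi / (1 / (2 * v)) = 2 * Real.pi * v by field_simp, ← Real.rpow_add (by positivity)]
  simp

lemma integrable_isoGaussianPDF (hv : 0 < v) : Integrable (isoGaussianPDF N v) :=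
  .of_integral_ne_zero (by rw [integral_isoGaussianPDF hv]; exact one_ne_zero)

lemma isProbabilityMeasure_isoGaussian (hv : 0 < v) : IsProbabilityMeasure (isoGaussian N v) := by
  constructor
  rw [isoGaussian, withDensity_apply _ .univ, Measure.restrict_univ,
    ← ofReal_integral_eq_lintegral_ofReal (integrable_isoGaussianPDF hv)
      (.of_forall fun x => (isoGaussianPDF_pos hv x).le), integral_isoGaussianPDF hv]
  simp

lemma isoGaussian_real_apply (hv : 0 < v) {A : Set (Space N)} (hA : MeasurableSet A) :
    (isoGaussian N v).real A = ∫ x in A, isoGaussianPDF N v x := by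
  rw [measureReal_def, isoGaussian, withDensity_apply _ hA,
    ← ofReal_integral_eq_lintegral_ofReal (integrable_isoGaussianPDF hv).integrableOn
      (.of_forall fun x => (isoGaussianPDF_pos hv x).le), ENNReal.toReal_ofReal]
  exact setIntegral_nonneg hA fun x _ => (isoGaussianPDF_pos hv x).le

open Complex in
lemma charFun_isoGaussian (hv : 0 < v) (t : Space N) :
    charFun (isoGaussian N v) t = cexp (-(v * ‖t‖ ^ 2 / 2)) := by
  rw [charFun_apply, isoGaussian, integral_withDensity_eq_integral_toReal_smul
    (by fun_prop) (by simp)]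
  have h := GaussianFourier.integral_cexp_neg_mul_sq_norm_add (V := Space N)
    (b := ((1 / (2 * v) : ℝ) : ℂ)) (by rw [Complex.ofReal_re]; positivity) I t
  have e : ∀ x : Space N, (ENNReal.ofReal (isoGaussianPDF N v x)).toReal •
      cexp (inner ℝ x t * I) = (((2 * Real.pi * v) ^ (-((N : ℝ) / 2)) : ℝ) : ℂ) *
        cexp (-((1 / (2 * v) : ℝ) : ℂ) * ‖x‖ ^ 2 + I * inner ℝ t x) := by
    intro x
    rw [ENNReal.toReal_ofReal (isoGaussianPDF_pos hv x).le, real_smul, isoGaussianPDF,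
      ofReal_mul, mul_assoc, ofReal_exp, ← Complex.exp_add, real_inner_comm t x]
    congr 2
    push_cast
    field_simp
  simp_rw [e]
  rw [integral_const_mul, h, finrank_euclideanSpace, Fintype.card_fin, ← mul_assoc]
  have e2 : (Real.pi / ((1 / (2 * v) : ℝ) : ℂ)) ^ (N / 2 : ℂ) =
      (((2 * Real.pi * v) ^ ((N : ℝ) / 2) : ℝ) : ℂ) := by
    rw [ofReal_cpow (by positivity)]
    push_cast
    congr 1
    field_simp
  rw [e2, ← ofReal_mul, ← Real.rpow_add (by positivity), neg_add_cancel, Real.rpow_zero,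
    ofReal_one, one_mul, I_sq]
  congr 1
  push_cast
  field_simp
  ring

/-- The density form is the one that Mehler's kernel produces, while Gaussianity, mean and
covariance are read off from `multivariateGaussian`. Equality of characteristic functions links the
two. -/
lemma isoGaussian_eq_multivariateGaussian (hv : 0 < v) :
    isoGaussian N v = multivariateGaussian 0 (v • (1 : Matrix (Fin N) (Fin N) ℝ)) := by
  have := isProbabilityMeasure_isoGaussian (N := N) hv
  refine Measure.ext_of_charFun ?_
  ext t
  rw [charFun_isoGaussian hv, charFun_multivariateGaussian (Matrix.PosSemidef.one.smul hv.le)]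
  have : (t.ofLp ⬝ᵥ (v • (1 : Matrix (Fin N) (Fin N) ℝ)).mulVec t.ofLp) = v * ‖t‖ ^ 2 := by
    rw [Matrix.smul_mulVec, Matrix.one_mulVec, dotProduct_smul, EuclideanSpace.real_norm_sq_eq]
    simp [dotProduct, sq]
  rw [this]
  congr 1
  simp

lemma isGaussian_isoGaussian (hv : 0 < v) : IsGaussian (isoGaussian N v) := by
  rw [isoGaussian_eq_multivariateGaussian hv]
  infer_instance

lemma integral_id_isoGaussian (hv : 0 < v) : ∫ x, x ∂(isoGaussian N v) = 0 := by
  rw [isoGaussian_eq_multivariateGaussian hv, integral_id_multivariateGaussian]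

lemma integral_coord_isoGaussian (hv : 0 < v) (i : Fin N) : ∫ x, x i ∂(isoGaussian N v) = 0 := by
  have := isGaussian_isoGaussian (N := N) hv
  have h := (EuclideanSpace.proj (𝕜 := ℝ) i).integral_comp_comm
    (IsGaussian.integrable_fun_id (μ := isoGaussian N v))
  rw [integral_id_isoGaussian hv, map_zero] at h
  simpa using h

lemma covariance_coord_isoGaussian (hv : 0 < v) (i j : Fin N) :
    cov[fun x => x i, fun x => x j; isoGaussian N v] = v * if i = j then 1 else 0 := by
  rw [isoGaussian_eq_multivariateGaussian hv,
    covariance_eval_multivariateGaussian (Matrix.PosSemidef.one.smul hv.le)]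
  simp [Matrix.one_apply]

end BernsteinOU

namespace BernsteinOU

/-! ### The Schauder system and the covariance of the Brownian bridge -/

/-- The projection of `ℝ` onto `[0, 1]`. -/
noncomputable def clamp (x : ℝ) : ℝ := max 0 (min x 1)

/-- The tent function. -/
noncomputable def tent (x : ℝ) : ℝ := max 0 (min x (1 - x))

/-- The covariance function of the Brownian bridge, extended to `ℝ²`. -/
noncomputable def bridgeCov (x y : ℝ) : ℝ :=
  min (clamp x) (clamp y) * (1 - max (clamp x) (clamp y))

@[fun_prop]
lemma continuous_tent : Continuous tent := by
  unfold tent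
  fun_prop

lemma clamp_mono {x y : ℝ} (h : x ≤ y) : clamp x ≤ clamp y :=
  max_le_max le_rfl (min_le_min h le_rfl)

lemma bridgeCov_of_le {x y : ℝ} (h : x ≤ y) : bridgeCov x y = clamp x * (1 - clamp y) := by
  rw [bridgeCov, min_eq_left (clamp_mono h), max_eq_right (clamp_mono h)]

lemma bridgeCov_comm (x y : ℝ) : bridgeCov x y = bridgeCov y x := by
  rw [bridgeCov, min_comm, max_comm, bridgeCov]

lemma clamp_nonneg (x : ℝ) : 0 ≤ clamp x := le_max_left _ _

lemma clamp_le_one (x : ℝ) : clamp x ≤ 1 := max_le zero_le_one (min_le_right _ _)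

lemma tent_nonneg (x : ℝ) : 0 ≤ tent x := le_max_left _ _

lemma clamp_of_nonpos {x : ℝ} (h : x ≤ 0) : clamp x = 0 := by
  rw [clamp, min_eq_left (by linarith), max_eq_left h]

lemma clamp_of_mem {x : ℝ} (h0 : 0 ≤ x) (h1 : x ≤ 1) : clamp x = x := by
  rw [clamp, min_eq_left h1, max_eq_right h0]

lemma clamp_of_one_le {x : ℝ} (h : 1 ≤ x) : clamp x = 1 := by
  rw [clamp, min_eq_right h, max_eq_right zero_le_one]

/-- These are the four intervals on which all the functions entering `bridgeCov_eq` are affine, so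
that the self-similarity becomes a list of polynomial identities. -/
lemma clamp_tent_cases (x : ℝ) :
    (x ≤ 0 ∧ clamp x = 0 ∧ clamp (2 * x) = 0 ∧ clamp (2 * x - 1) = 0 ∧ tent x = 0) ∨
    (0 ≤ x ∧ x ≤ 1 / 2 ∧ clamp x = x ∧ clamp (2 * x) = 2 * x ∧ clamp (2 * x - 1) = 0 ∧
      tent x = x) ∨
    (1 / 2 ≤ x ∧ x ≤ 1 ∧ clamp x = x ∧ clamp (2 * x) = 1 ∧ clamp (2 * x - 1) = 2 * x - 1 ∧
      tent x = 1 - x) ∨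
    (1 ≤ x ∧ clamp x = 1 ∧ clamp (2 * x) = 1 ∧ clamp (2 * x - 1) = 1 ∧ tent x = 0) := by
  rcases le_total x 0 with h0 | h0
  · refine Or.inl ⟨h0, clamp_of_nonpos h0, clamp_of_nonpos (by linarith),
      clamp_of_nonpos (by linarith), ?_⟩
    rw [tent, min_eq_left (by linarith), max_eq_left h0]
  rcases le_total x (1 / 2) with h1 | h1
  · refine Or.inr (Or.inl ⟨h0, h1, clamp_of_mem h0 (by linarith),
      clamp_of_mem (by linarith) (by linarith), clamp_of_nonpos (by linarith), ?_⟩)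
    rw [tent, min_eq_left (by linarith), max_eq_right h0]
  rcases le_total x 1 with h2 | h2
  · refine Or.inr (Or.inr (Or.inl ⟨h1, h2, clamp_of_mem h0 h2, clamp_of_one_le (by linarith),
      clamp_of_mem (by linarith) (by linarith), ?_⟩))
    rw [tent, min_eq_right (by linarith), max_eq_right (by linarith)]
  · refine Or.inr (Or.inr (Or.inr ⟨h2, clamp_of_one_le h2, clamp_of_one_le (by linarith),
      clamp_of_one_le (by linarith), ?_⟩))
    rw [tent, min_eq_right (by linarith), max_eq_left (by linarith)]

/-- The self-similarity of the covariance of the Brownian bridge. -/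
lemma bridgeCov_eq (x y : ℝ) :
    bridgeCov x y = tent x * tent y +
      1 / 2 * (bridgeCov (2 * x) (2 * y) + bridgeCov (2 * x - 1) (2 * y - 1)) := by
  wlog h : x ≤ y generalizing x y
  · rw [bridgeCov_comm, this y x (le_of_not_ge h), bridgeCov_comm (2 * x),
      bridgeCov_comm (2 * x - 1), mul_comm (tent x)]
  rw [bridgeCov_of_le h, bridgeCov_of_le (by linarith), bridgeCov_of_le (by linarith)]
  -- The assumption `x ≤ y` has served to remove the minima and maxima. The resulting identity in
  -- `clamp x` and `1 - clamp y` holds in all sixteen cases, even those incompatible with `x ≤ y`.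
  rcases clamp_tent_cases x with ⟨hx, a1, a2, a3, a4⟩ | ⟨hx, hx', a1, a2, a3, a4⟩ |
    ⟨hx, hx', a1, a2, a3, a4⟩ | ⟨hx, a1, a2, a3, a4⟩ <;>
  rcases clamp_tent_cases y with ⟨hy, b1, b2, b3, b4⟩ | ⟨hy, hy', b1, b2, b3, b4⟩ |
    ⟨hy, hy', b1, b2, b3, b4⟩ | ⟨hy, b1, b2, b3, b4⟩ <;>
  rw [a1, a2, a3, a4, b1, b2, b3, b4] <;>
  ring

/-- The sum telescopes. As `tent` and `bridgeCov` are dominated by the difference `clamp (x + 1) -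
clamp x`, their sums over integer translates are at most 1, whatever the number of translates. -/
lemma sum_clamp_sub_le (x : ℝ) (M : ℕ) :
    ∑ k ∈ Finset.range M, (clamp (x - k + 1) - clamp (x - k)) ≤ 1 := by
  have : ∑ k ∈ Finset.range M, (clamp (x - k + 1) - clamp (x - k)) =
      clamp (x + 1) - clamp (x - M + 1) := by
    induction M with
    | zero => simp
    | succ M ih =>
      rw [Finset.sum_range_succ, ih]
      push_cast
      rw [show x - (M + 1) + 1 = x - M by ring]
      ring
  rw [this]
  linarith [clamp_le_one (x + 1), clamp_nonneg (x - M + 1)]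

lemma tent_le (x : ℝ) : tent x ≤ clamp (x + 1) - clamp x := by
  rcases clamp_tent_cases x with ⟨hx, a1, -, -, a4⟩ | ⟨hx, hx', a1, -, -, a4⟩ |
    ⟨hx, hx', a1, -, -, a4⟩ | ⟨hx, a1, -, -, a4⟩
  · rw [a1, a4]; linarith [clamp_nonneg (x + 1)]
  all_goals linarith [clamp_of_one_le (x := x + 1) (by linarith)]

lemma bridgeCov_nonneg (x y : ℝ) : 0 ≤ bridgeCov x y :=
  mul_nonneg (le_min (clamp_nonneg x) (clamp_nonneg y))
    (sub_nonneg.2 (max_le (clamp_le_one x) (clamp_le_one y)))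

lemma bridgeCov_le (x y : ℝ) : bridgeCov x y ≤ clamp (x + 1) - clamp x := by
  have h : bridgeCov x y ≤ clamp x * (1 - clamp x) :=
    mul_le_mul (min_le_left _ _) (sub_le_sub_left (le_max_left _ _) _)
      (sub_nonneg.2 (max_le (clamp_le_one x) (clamp_le_one y))) (clamp_nonneg x)
  refine h.trans ?_
  rcases le_total x 0 with h0 | h0
  · rw [clamp_of_nonpos h0]; linarith [clamp_nonneg (x + 1)]
  · rw [clamp_of_one_le (x := x + 1) (by linarith)]
    nlinarith [clamp_le_one x, clamp_nonneg x]

lemma sum_tent_le (x : ℝ) (M : ℕ) : ∑ k ∈ Finset.range M, tent (x - k) ≤ 1 :=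
  (Finset.sum_le_sum fun _ _ => tent_le _).trans (sum_clamp_sub_le x M)

lemma sum_range_two_mul (f : ℕ → ℝ) (M : ℕ) :
    ∑ k ∈ Finset.range (2 * M), f k = ∑ k ∈ Finset.range M, (f (2 * k) + f (2 * k + 1)) := by
  induction M with
  | zero => simp
  | succ M ih =>
    rw [Finset.sum_range_succ, ← ih, show 2 * (M + 1) = 2 * M + 1 + 1 by ring,
      Finset.sum_range_succ, Finset.sum_range_succ]
    ring

/-- The remainder of the expansion of `bridgeCov` in the Schauder system. -/
noncomputable def bridgeCovRem (m : ℕ) (s t : ℝ) : ℝ :=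
  (1 / 2) ^ m * ∑ k ∈ Finset.range (2 ^ m), bridgeCov (2 ^ m * s - k) (2 ^ m * t - k)

/-- Apply `bridgeCov_eq` on each dyadic interval: interval `k` of level `m` has the halves `2 k` and
`2 k + 1` of level `m + 1`, and its tents supply the terms of level `m`. -/
lemma bridgeCovRem_succ (m : ℕ) (s t : ℝ) :
    bridgeCovRem m s t = (1 / 2) ^ m * ∑ k ∈ Finset.range (2 ^ m),
      tent (2 ^ m * s - k) * tent (2 ^ m * t - k) + bridgeCovRem (m + 1) s t := by
  rw [bridgeCovRem, bridgeCovRem, pow_succ' 2 m, sum_range_two_mul, pow_succ (1 / 2 : ℝ),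
    mul_assoc, ← mul_add]
  congr 1
  rw [Finset.mul_sum, ← Finset.sum_add_distrib]
  refine Finset.sum_congr rfl fun k _ => ?_
  rw [bridgeCov_eq]
  have e1 : ∀ u : ℝ, 2 ^ (m + 1) * u - ((2 * k : ℕ) : ℝ) = 2 * (2 ^ m * u - k) := by
    intro u; push_cast; ring
  have e2 : ∀ u : ℝ, 2 ^ (m + 1) * u - ((2 * k + 1 : ℕ) : ℝ) = 2 * (2 ^ m * u - k) - 1 := by
    intro u; push_cast; ring
  rw [e1, e1, e2, e2]

lemma sum_tent_mul_tent (m : ℕ) (s t : ℝ) :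
    ∑ n ∈ Finset.range m, (1 / 2) ^ n * ∑ k ∈ Finset.range (2 ^ n),
      tent (2 ^ n * s - k) * tent (2 ^ n * t - k) = bridgeCov s t - bridgeCovRem m s t := by
  induction m with
  | zero => simp [bridgeCovRem]
  | succ m ih =>
    rw [Finset.sum_range_succ, ih, bridgeCovRem_succ m]
    ring

lemma tendsto_bridgeCovRem (s t : ℝ) :
    Filter.Tendsto (fun m => bridgeCovRem m s t) Filter.atTop (nhds 0) := by
  refine squeeze_zero (fun m => ?_) (fun m => ?_)
    (tendsto_pow_atTop_nhds_zero_of_lt_one (r := (1 / 2 : ℝ)) (by norm_num) (by norm_num))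
  · exact mul_nonneg (by positivity) (Finset.sum_nonneg fun _ _ => bridgeCov_nonneg _ _)
  · refine mul_le_of_le_one_right (by positivity) ?_
    exact (Finset.sum_le_sum fun _ _ => bridgeCov_le _ _).trans (sum_clamp_sub_le _ _)

end BernsteinOU

/-! ### White noise and the Schauder construction of the Brownian bridge. -/

/-- Finite linear combinations of a Gaussian process form a Gaussian process. -/
theorem ProbabilityTheory.IsGaussianProcess.sum_mul {Ω S S' ι : Type*} {mΩ : MeasurableSpace Ω}
    {P : Measure Ω} {X : S → Ω → ℝ} (hX : IsGaussianProcess X P) (J : S' → Finset ι)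
    (c : S' → ι → ℝ) (φ : S' → ι → S) :
    IsGaussianProcess (fun t ω => ∑ p ∈ J t, c t p * X (φ t p) ω) P := by
  classical
  refine hX.of_isGaussianProcess fun t => ⟨(J t).image (φ t), ∑ p : J t, c t p •
    ContinuousLinearMap.proj ⟨φ t p, Finset.mem_image_of_mem _ p.2⟩, fun ω => ?_⟩
  rw [← Finset.sum_coe_sort]
  simp

/-- A family of independent standard normal variables, as a Gaussian process. -/
structure BernsteinOU.IsWhiteNoise {Ω S : Type*} {mΩ : MeasurableSpace Ω}
    (ξ : S → Ω → ℝ) (P : Measure Ω) : Prop where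
  measurable : ∀ p, Measurable (ξ p)
  law : ∀ p, P.map (ξ p) = gaussianReal 0 1
  indep : iIndepFun ξ P

namespace BernsteinOU

lemma isWhiteNoise_infinitePi (S : Type*) :
    IsWhiteNoise (fun (p : S) (ω : S → ℝ) => ω p)
      (Measure.infinitePi fun _ : S => gaussianReal 0 1) where
  measurable p := measurable_pi_apply p
  law p := Measure.infinitePi_map_eval _ p
  indep := iIndepFun_infinitePi (P := fun _ : S => gaussianReal 0 1)
    (X := fun _ x => x) fun _ => measurable_id

namespace IsWhiteNoise

variable {Ω S : Type*} {mΩ : MeasurableSpace Ω} {P : Measure Ω} {ξ : S → Ω → ℝ}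

lemma hasLaw (h : IsWhiteNoise ξ P) (p : S) : HasLaw (ξ p) (gaussianReal 0 1) P :=
  ⟨(h.measurable p).aemeasurable, h.law p⟩

lemma isGaussianProcess (h : IsWhiteNoise ξ P) : IsGaussianProcess ξ P where
  hasGaussianLaw _ := (h.indep.precomp Subtype.val_injective).hasGaussianLaw
    fun p => (h.hasLaw p).hasGaussianLaw

lemma memLp_two (h : IsWhiteNoise ξ P) (p : S) : MemLp (ξ p) 2 P :=
  (h.hasLaw p).hasGaussianLaw.memLp_two

lemma integral_eq (h : IsWhiteNoise ξ P) (p : S) : P[ξ p] = 0 := by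
  rw [(h.hasLaw p).integral_eq, integral_id_gaussianReal]

lemma covariance_self (h : IsWhiteNoise ξ P) (p : S) : cov[ξ p, ξ p; P] = 1 := by
  rw [ProbabilityTheory.covariance_self (h.measurable p).aemeasurable, (h.hasLaw p).variance_eq,
    variance_id_gaussianReal]
  simp

lemma covariance_of_ne (h : IsWhiteNoise ξ P) {p q : S} (hpq : p ≠ q) : cov[ξ p, ξ q; P] = 0 :=
  (h.indep.indepFun hpq).covariance_eq_zero (h.memLp_two p) (h.memLp_two q)

lemma covariance_sum_mul (h : IsWhiteNoise ξ P) [IsProbabilityMeasure P] (J : Finset S)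
    (c d : S → ℝ) :
    cov[fun ω => ∑ p ∈ J, c p * ξ p ω, fun ω => ∑ p ∈ J, d p * ξ p ω; P] =
      ∑ p ∈ J, c p * d p := by
  rw [covariance_fun_sum_fun_sum' (fun p _ => (h.memLp_two p).const_mul _)
    fun p _ => (h.memLp_two p).const_mul _]
  refine Finset.sum_congr rfl fun p hp => ?_
  rw [Finset.sum_eq_single_of_mem p hp]
  · rw [covariance_const_mul_left, covariance_const_mul_right, h.covariance_self, mul_one]
  · intro q _ hq
    rw [covariance_const_mul_left, covariance_const_mul_right, h.covariance_of_ne hq.symm]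
    simp

end IsWhiteNoise

section Bridge

variable {Ω : Type*} {mΩ : MeasurableSpace Ω} {P : Measure Ω} {ξ : (_ : ℕ) × ℕ → Ω → ℝ}

/-- The `n`-th level of the Schauder expansion of the Brownian bridge. -/
noncomputable def bridgeLevel (ξ : (_ : ℕ) × ℕ → Ω → ℝ) (n : ℕ) (t : ℝ) (ω : Ω) : ℝ :=
  ∑ k ∈ Finset.range (2 ^ n), (√(1 / 2) ^ n * tent (2 ^ n * t - k)) * ξ ⟨n, k⟩ ω

/-- The weighted sum of fourth powers that controls the Schauder expansion. -/
noncomputable def bridgeBound (ξ : (_ : ℕ) × ℕ → Ω → ℝ) (ω : Ω) : ℝ≥0∞ :=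
  ∑' n : ℕ, ∑ k ∈ Finset.range (2 ^ n), ENNReal.ofReal (((4 / 5) ^ n * ξ ⟨n, k⟩ ω) ^ 4)

/-- The Brownian bridge defined by its Schauder expansion. -/
noncomputable def bridge (ξ : (_ : ℕ) × ℕ → Ω → ℝ) (t : ℝ) (ω : Ω) : ℝ :=
  {ω | bridgeBound ξ ω < ∞}.indicator (fun ω => ∑' n, bridgeLevel ξ n t ω) ω

lemma measurable_bridgeBound (hξ : IsWhiteNoise ξ P) : Measurable (bridgeBound ξ) := by
  have := hξ.measurable
  unfold bridgeBound
  fun_prop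

lemma measurable_bridge (hξ : IsWhiteNoise ξ P) (t : ℝ) : Measurable (bridge ξ t) := by
  have := hξ.measurable
  refine Measurable.indicator ?_ (measurable_bridgeBound hξ measurableSet_Iio)
  refine Measurable.tsum fun n => ?_
  unfold bridgeLevel
  fun_prop

/-- The expectation is finite: level `n` has `2 ^ n` terms with equal means, so it contributes a
multiple of `(2 (4/5)^4)^n`, and `2 (4/5)^4 = 512/625 < 1`. The ratio `q = 4/5` must satisfy `2 q^4
< 1` here and `√(1/2) / q < 1` in `summable_bridgeLevel_bound`. With second moments in place of
fourth ones the two conditions would exclude each other. -/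
lemma ae_bridgeBound_lt_top (hξ : IsWhiteNoise ξ P) : ∀ᵐ ω ∂P, bridgeBound ξ ω < ∞ := by
  have hm := hξ.measurable
  refine ae_lt_top (measurable_bridgeBound hξ) ?_
  set M : ℝ≥0∞ := ∫⁻ x, ENNReal.ofReal (x ^ 4) ∂(gaussianReal 0 1) with hM
  have hMfin : M ≠ ∞ := by
    have h : Integrable (fun x : ℝ => ‖x‖ ^ 4) (gaussianReal 0 1) :=
      (memLp_id_gaussianReal 4).integrable_norm_pow (by norm_num)
    have := h.lintegral_lt_top.ne
    simpa [hM, Even.pow_abs (show Even 4 by decide)] using this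
  have hterm : ∀ n k, ∫⁻ ω, ENNReal.ofReal (((4 / 5) ^ n * ξ ⟨n, k⟩ ω) ^ 4) ∂P =
      ENNReal.ofReal ((4 / 5) ^ 4) ^ n * M := by
    intro n k
    rw [hM, ← hξ.law ⟨n, k⟩, lintegral_map (by fun_prop) (hm _),
      ← lintegral_const_mul _ (by fun_prop)]
    refine lintegral_congr fun ω => ?_
    rw [← ENNReal.ofReal_pow (by positivity), ← ENNReal.ofReal_mul (by positivity)]
    rw [mul_pow, ← pow_mul, ← pow_mul, mul_comm n 4]
  unfold bridgeBound
  rw [lintegral_tsum (fun n => by fun_prop)]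
  have hlev : ∀ n, ∫⁻ ω, ∑ k ∈ Finset.range (2 ^ n),
      ENNReal.ofReal (((4 / 5) ^ n * ξ ⟨n, k⟩ ω) ^ 4) ∂P =
      ENNReal.ofReal (2 * (4 / 5) ^ 4) ^ n * M := by
    intro n
    rw [lintegral_finsetSum _ (fun k _ => by fun_prop)]
    simp_rw [hterm]
    rw [Finset.sum_const, Finset.card_range, nsmul_eq_mul, ENNReal.ofReal_mul (by norm_num),
      mul_pow, mul_assoc]
    simp
  simp_rw [hlev]
  rw [ENNReal.tsum_mul_right]
  refine ENNReal.mul_ne_top ?_ hMfin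
  rw [ENNReal.tsum_geometric]
  refine ENNReal.inv_ne_top.2 (tsub_pos_iff_lt.2 ?_).ne'
  rw [ENNReal.ofReal_lt_one]
  norm_num

/-- Each coefficient of level `n` is bounded through its own term in `bridgeBound`, and the tents of
one level sum to at most 1 at any time. The bound is uniform in `t`, as the continuity of the series
requires. -/
lemma abs_bridgeLevel_le {ω : Ω} (hω : bridgeBound ξ ω < ∞) (n : ℕ) (t : ℝ) :
    |bridgeLevel ξ n t ω| ≤ (1 + (bridgeBound ξ ω).toReal) * (√(1 / 2) * (5 / 4)) ^ n := by
  have hξ : ∀ k ∈ Finset.range (2 ^ n),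
      |ξ ⟨n, k⟩ ω| ≤ (1 + (bridgeBound ξ ω).toReal) * (5 / 4) ^ n := by
    intro k hk
    have h1 : ENNReal.ofReal (((4 / 5) ^ n * ξ ⟨n, k⟩ ω) ^ 4) ≤ bridgeBound ξ ω :=
      (Finset.single_le_sum (f := fun k => ENNReal.ofReal (((4 / 5) ^ n * ξ ⟨n, k⟩ ω) ^ 4))
        (fun _ _ => zero_le) hk).trans (ENNReal.le_tsum n)
    have h2 : ((4 / 5) ^ n * ξ ⟨n, k⟩ ω) ^ 4 ≤ (bridgeBound ξ ω).toReal :=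
      (ENNReal.ofReal_le_iff_le_toReal hω.ne).1 h1
    have h3 : |(4 / 5) ^ n * ξ ⟨n, k⟩ ω| ≤ 1 + (bridgeBound ξ ω).toReal := by
      rw [← Even.pow_abs (show Even 4 by decide)] at h2
      -- The bound `1 + B` replaces the fourth root of `B`: a number above `1 + B ≥ 1` is at most
      -- its fourth power, hence at most `B`, a contradiction.
      by_contra! h
      have h4 : (0 : ℝ) ≤ (bridgeBound ξ ω).toReal := ENNReal.toReal_nonneg
      have h5 : |(4 / 5) ^ n * ξ ⟨n, k⟩ ω| ≤ |(4 / 5) ^ n * ξ ⟨n, k⟩ ω| ^ 4 :=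
        le_self_pow₀ (by linarith) (by norm_num)
      linarith
    rw [abs_mul, abs_of_nonneg (by positivity)] at h3
    calc |ξ ⟨n, k⟩ ω| = (4 / 5) ^ n * |ξ ⟨n, k⟩ ω| * (5 / 4) ^ n := by
          rw [mul_right_comm, ← mul_pow]; norm_num
      _ ≤ _ := by gcongr
  calc |bridgeLevel ξ n t ω|
      ≤ ∑ k ∈ Finset.range (2 ^ n), |(√(1 / 2) ^ n * tent (2 ^ n * t - k)) * ξ ⟨n, k⟩ ω| :=
        Finset.abs_sum_le_sum_abs _ _
    _ ≤ ∑ k ∈ Finset.range (2 ^ n), (√(1 / 2) ^ n * tent (2 ^ n * t - k)) *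
          ((1 + (bridgeBound ξ ω).toReal) * (5 / 4) ^ n) := by
        refine Finset.sum_le_sum fun k hk => ?_
        have h0 : 0 ≤ √(1 / 2) ^ n * tent (2 ^ n * t - k) :=
          mul_nonneg (by positivity) (tent_nonneg _)
        rw [abs_mul, abs_of_nonneg h0]
        exact mul_le_mul_of_nonneg_left (hξ k hk) h0
    _ = (∑ k ∈ Finset.range (2 ^ n), tent (2 ^ n * t - k)) *
          ((1 + (bridgeBound ξ ω).toReal) * (√(1 / 2) * (5 / 4)) ^ n) := by
        rw [Finset.sum_mul]
        refine Finset.sum_congr rfl fun k _ => ?_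
        rw [mul_pow]
        ring
    _ ≤ _ := mul_le_of_le_one_left (by positivity) (sum_tent_le _ _)

lemma summable_bridgeLevel_bound (C : ℝ) : Summable fun n : ℕ => C * (√(1 / 2) * (5 / 4)) ^ n := by
  refine (summable_geometric_of_lt_one (by positivity) ?_).mul_left C
  have : √(1 / 2) < 4 / 5 := by
    rw [Real.sqrt_lt' (by norm_num)]
    norm_num
  linarith

/-- Setting the bridge to 0 where `bridgeBound` is infinite makes every path continuous, not merely
almost every one. -/
lemma continuous_bridge (ω : Ω) : Continuous fun t => bridge ξ t ω := by
  by_cases hω : bridgeBound ξ ω < ∞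
  · have : (fun t => bridge ξ t ω) = fun t => ∑' n, bridgeLevel ξ n t ω := by
      ext t
      exact Set.indicator_of_mem (s := {ω | bridgeBound ξ ω < ∞}) hω _
    rw [this]
    refine continuous_tsum (fun n => ?_) (summable_bridgeLevel_bound _)
      fun n t => abs_bridgeLevel_le hω n t
    unfold bridgeLevel
    fun_prop
  · have : (fun t => bridge ξ t ω) = fun _ => 0 := by
      ext t
      exact Set.indicator_of_notMem (s := {ω | bridgeBound ξ ω < ∞}) hω _
    rw [this]
    exact continuous_const

/-- Partial sums of the series are finite combinations of the white noise with covariance `bridgeCov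
- bridgeCovRem`. They converge almost surely, and `of_ae_tendsto` carries Gaussianity, centering and
covariances to the limit. -/
lemma bridge_isGaussianProcess_and_covariance [IsProbabilityMeasure P] (hξ : IsWhiteNoise ξ P) :
    IsGaussianProcess (bridge ξ) P ∧ (∀ t, P[bridge ξ t] = 0) ∧
      ∀ s t, cov[bridge ξ s, bridge ξ t; P] = bridgeCov s t := by
  set J : ℕ → Finset ((_ : ℕ) × ℕ) := fun m =>
    (Finset.range m).sigma fun n => Finset.range (2 ^ n) with hJ
  set c : ℝ → (_ : ℕ) × ℕ → ℝ := fun t p => √(1 / 2) ^ p.1 * tent (2 ^ p.1 * t - p.2) with hc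
  have hlim : ∀ t, ∀ᵐ ω ∂P, Filter.Tendsto (fun m => ∑ p ∈ J m, c t p * ξ p ω) Filter.atTop
      (nhds (bridge ξ t ω)) := by
    intro t
    filter_upwards [ae_bridgeBound_lt_top hξ] with ω hω
    have hs : Summable fun n => bridgeLevel ξ n t ω :=
      .of_norm_bounded (summable_bridgeLevel_bound _) fun n => abs_bridgeLevel_le hω n t
    have e : bridge ξ t ω = ∑' n, bridgeLevel ξ n t ω :=
      Set.indicator_of_mem (s := {ω | bridgeBound ξ ω < ∞}) hω _
    rw [e]
    refine hs.hasSum.tendsto_sum_nat.congr fun m => ?_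
    rw [hJ, Finset.sum_sigma]
    rfl
  obtain ⟨h1, h2, h3⟩ := IsGaussianProcess.of_ae_tendsto (P := P)
    (X := fun m t ω => ∑ p ∈ J m, c t p * ξ p ω) (Y := bridge ξ)
    (fun m => hξ.isGaussianProcess.sum_mul (fun _ => J m) c fun _ p => p) (fun m t => by
      rw [integral_finsetSum _ fun p _ => ((hξ.memLp_two p).integrable one_le_two).const_mul _]
      simp [integral_const_mul, hξ.integral_eq]) hlim
  refine ⟨h1, h2, fun s t => tendsto_nhds_unique (h3 s t) ?_⟩
  have := (tendsto_bridgeCovRem s t).const_sub (bridgeCov s t)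
  rw [sub_zero] at this
  refine this.congr fun m => ?_
  rw [hξ.covariance_sum_mul, hJ, Finset.sum_sigma, ← sum_tent_mul_tent]
  refine Finset.sum_congr rfl fun n _ => ?_
  rw [Finset.mul_sum]
  refine Finset.sum_congr rfl fun k _ => ?_
  rw [hc]
  have : √(1 / 2 : ℝ) ^ n * √(1 / 2) ^ n = (1 / 2) ^ n := by
    rw [← mul_pow, Real.mul_self_sqrt (by norm_num)]
  calc _ = (√(1 / 2 : ℝ) ^ n * √(1 / 2) ^ n) * (tent (2 ^ n * s - k) * tent (2 ^ n * t - k)) := by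
        rw [this]
    _ = _ := by ring

end Bridge

end BernsteinOU

/-! ### Time integrals of continuous processes. -/

open Filter Topology in
/-- Left Riemann sums of a continuous function converge to its integral. -/
theorem tendsto_left_riemann_sum {f : ℝ → ℝ} (hf : Continuous f) {t : ℝ} (ht : 0 ≤ t) :
    Tendsto (fun n : ℕ => t / (n + 1) * ∑ k ∈ Finset.range (n + 1), f (t * k / (n + 1))) atTop
      (𝓝 (∫ r in (0 : ℝ)..t, f r)) := by
  have huc : UniformContinuousOn f (Set.Icc 0 t) :=
    isCompact_Icc.uniformContinuousOn_of_continuous hf.continuousOn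
  rw [Metric.tendsto_atTop]
  intro ε hε
  -- With modulus `ε / (t + 1)` the total error is at most `ε t / (t + 1)`, strictly below `ε` also
  -- when `t = 0`.
  obtain ⟨δ, hδ, hfδ⟩ := Metric.uniformContinuousOn_iff.1 huc (ε / (t + 1)) (by positivity)
  obtain ⟨n₀, hn₀⟩ := exists_nat_gt (t / δ)
  refine ⟨n₀, fun n hn => ?_⟩
  have hn1 : (0 : ℝ) < n + 1 := by positivity
  have hstep : t / (n + 1) < δ := by
    rw [div_lt_iff₀ hn1, ← div_lt_iff₀' hδ]
    have : (n₀ : ℝ) ≤ n := by exact_mod_cast hn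
    linarith
  set a : ℕ → ℝ := fun k => t * k / (n + 1) with ha
  have ha_sub : ∀ k, a (k + 1) - a k = t / (n + 1) := by
    intro k
    simp only [ha]
    push_cast
    ring
  have hsum : ∫ r in (0 : ℝ)..t, f r = ∑ k ∈ Finset.range (n + 1), ∫ r in a k..a (k + 1), f r := by
    rw [intervalIntegral.sum_integral_adjacent_intervals fun k _ => hf.intervalIntegrable _ _]
    congr 1
    · simp [ha]
    · simp only [ha]
      push_cast
      field_simp
  have hle : ∀ k ∈ Finset.range (n + 1),
      ‖t / (n + 1) * f (a k) - ∫ r in a k..a (k + 1), f r‖ ≤ ε / (t + 1) * (t / (n + 1)) := by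
    intro k hk
    have hmono : a k ≤ a (k + 1) := by
      rw [← sub_nonneg, ha_sub]
      positivity
    have h0 : 0 ≤ a k := by positivity
    have h1 : a (k + 1) ≤ t := by
      simp only [ha]
      rw [div_le_iff₀ hn1]
      have : ((k + 1 : ℕ) : ℝ) ≤ n + 1 := by exact_mod_cast Finset.mem_range.1 hk
      gcongr
    have e : t / (n + 1) * f (a k) - ∫ r in a k..a (k + 1), f r =
        ∫ r in a k..a (k + 1), (f (a k) - f r) := by
      rw [intervalIntegral.integral_sub intervalIntegrable_const (hf.intervalIntegrable _ _),
        intervalIntegral.integral_const, ha_sub, smul_eq_mul]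
    rw [e, ← ha_sub k, ← abs_of_nonneg (sub_nonneg.2 hmono)]
    refine intervalIntegral.norm_integral_le_of_norm_le_const fun r hr => ?_
    rw [Set.uIoc_of_le hmono] at hr
    rw [← dist_eq_norm]
    refine (hfδ _ ⟨h0, hmono.trans h1⟩ _ ⟨h0.trans hr.1.le, hr.2.trans h1⟩ ?_).le
    rw [dist_comm, Real.dist_eq, abs_of_nonneg (sub_nonneg.2 hr.1.le)]
    linarith [ha_sub k, hr.2]
  rw [dist_eq_norm, hsum, Finset.mul_sum, ← Finset.sum_sub_distrib]
  refine (norm_sum_le_of_le _ hle).trans_lt ?_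
  rw [Finset.sum_const, Finset.card_range, nsmul_eq_mul]
  have : ((n + 1 : ℕ) : ℝ) * (ε / (t + 1) * (t / (n + 1))) = ε * (t / (t + 1)) := by
    push_cast
    field_simp
  rw [this]
  refine mul_lt_of_lt_one_right hε ?_
  rw [div_lt_one (by positivity)]
  linarith

/-- The mean against `Y` of the time integral of a process with continuous paths. -/
theorem integral_mul_intervalIntegral_eq {Ω : Type*} {mΩ : MeasurableSpace Ω} {P : Measure Ω}
    [IsProbabilityMeasure P] {Y : Ω → ℝ} (mY : Measurable Y) (hY : MemLp Y 2 P) {X : ℝ → Ω → ℝ}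
    (mX : ∀ r, Measurable (X r)) (hcont : ∀ ω, Continuous fun r => X r ω)
    (hX : ∀ r, MemLp (X r) 2 P) {t C : ℝ} (ht : 0 ≤ t)
    (hC : ∀ r ∈ Set.Icc 0 t, ∫ ω, X r ω ^ 2 ∂P ≤ C) :
    Integrable (fun ω => Y ω * ∫ r in (0 : ℝ)..t, X r ω) P ∧
      ∫ ω, Y ω * (∫ r in (0 : ℝ)..t, X r ω) ∂P =
        ∫ r in (0 : ℝ)..t, ∫ ω, Y ω * X r ω ∂P := by
  have hXm : Measurable (Function.uncurry X) :=
    (stronglyMeasurable_uncurry_of_continuous_of_stronglyMeasurable hcont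
      fun r => (mX r).stronglyMeasurable).measurable
  have hm : Measurable fun q : Ω × ℝ => Y q.1 * X q.2 q.1 :=
    (mY.comp measurable_fst).mul (hXm.comp measurable_swap)
  have hint : Integrable (fun q : Ω × ℝ => Y q.1 * X q.2 q.1)
      (P.prod (volume.restrict (Set.Ioc 0 t))) := by
    rw [integrable_prod_iff' hm.aestronglyMeasurable]
    refine ⟨.of_forall fun r => hY.integrable_mul (hX r), ?_⟩
    -- The constant comes from `|ab| ≤ (a² + b²) / 2` and the uniform bound on second moments; it is
    -- what makes Fubini's theorem applicable.
    refine Integrable.of_bound (C := (∫ ω, Y ω ^ 2 ∂P + C) / 2)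
      hm.norm.stronglyMeasurable.integral_prod_left'.aestronglyMeasurable ?_
    filter_upwards [ae_restrict_mem measurableSet_Ioc] with r hr
    rw [Real.norm_of_nonneg (integral_nonneg fun _ => norm_nonneg _)]
    calc ∫ ω, ‖Y ω * X r ω‖ ∂P ≤ ∫ ω, (Y ω ^ 2 + X r ω ^ 2) / 2 ∂P := by
          refine integral_mono (hY.integrable_mul (hX r)).norm
            ((hY.integrable_sq.add (hX r).integrable_sq).div_const 2) fun ω => ?_
          rw [Real.norm_eq_abs, abs_mul]
          nlinarith [sq_nonneg (|Y ω| - |X r ω|), sq_abs (Y ω), sq_abs (X r ω)]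
      _ = (∫ ω, Y ω ^ 2 ∂P + ∫ ω, X r ω ^ 2 ∂P) / 2 := by
          rw [integral_div, integral_add hY.integrable_sq (hX r).integrable_sq]
      _ ≤ _ := by gcongr; exact hC r ⟨hr.1.le, hr.2⟩
  simp_rw [intervalIntegral.integral_of_le ht, ← integral_const_mul]
  exact ⟨hint.integral_prod_left, integral_integral_swap hint⟩

/-! ### The Ornstein-Uhlenbeck process as a time-changed Brownian bridge. -/

namespace BernsteinOU

/-- The covariance of the Ornstein-Uhlenbeck process started at the origin. -/
noncomputable def ouCov (lam s t : ℝ) : ℝ :=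
  Real.exp (-(lam * (t + s))) / (2 * lam) * (Real.exp (2 * lam * min t s) - 1)

lemma ouCov_comm (lam s t : ℝ) : ouCov lam s t = ouCov lam t s := by
  rw [ouCov, ouCov, min_comm, add_comm]

lemma ouCov_of_le {lam s t : ℝ} (h : s ≤ t) :
    ouCov lam s t = Real.exp (-(lam * (t + s))) / (2 * lam) * (Real.exp (2 * lam * s) - 1) := by
  rw [ouCov, min_eq_right h]

/-- The variance of the martingale part of the Ornstein-Uhlenbeck process. -/
noncomputable def ouClock (lam t : ℝ) : ℝ := (Real.exp (2 * lam * t) - 1) / (2 * lam)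

lemma ouClock_nonneg {lam t : ℝ} (hlam : 0 < lam) (ht : 0 ≤ t) : 0 ≤ ouClock lam t :=
  div_nonneg (sub_nonneg.2 (Real.one_le_exp (by positivity))) (by positivity)

lemma ouClock_mono {lam s t : ℝ} (hlam : 0 < lam) (h : s ≤ t) :
    ouClock lam s ≤ ouClock lam t := by
  unfold ouClock
  gcongr

@[fun_prop]
lemma continuous_ouClock {lam : ℝ} : Continuous (ouClock lam) := by
  unfold ouClock
  fun_prop

section OrnsteinUhlenbeck

variable {Ω : Type*} {mΩ : MeasurableSpace Ω} {P : Measure Ω} {ξ : (_ : ℕ) × ℕ → Ω → ℝ} {lam : ℝ}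

/-- The Ornstein-Uhlenbeck process started at the origin, as a deterministic transformation of a
Brownian bridge. -/
noncomputable def ouProcess (lam : ℝ) (ξ : (_ : ℕ) × ℕ → Ω → ℝ) (t : ℝ) (ω : Ω) : ℝ :=
  Real.exp (-(lam * max t 0)) * (1 + ouClock lam (max t 0)) *
    bridge ξ (ouClock lam (max t 0) / (1 + ouClock lam (max t 0))) ω

/-- The Brownian motion that drives the Ornstein-Uhlenbeck process. -/
noncomputable def ouNoise (lam : ℝ) (ξ : (_ : ℕ) × ℕ → Ω → ℝ) (t : ℝ≥0) (ω : Ω) : ℝ :=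
  ouProcess lam ξ t ω + lam * ∫ r in (0 : ℝ)..t, ouProcess lam ξ r ω

lemma measurable_ouProcess (hξ : IsWhiteNoise ξ P) (t : ℝ) : Measurable (ouProcess lam ξ t) :=
  (measurable_bridge hξ _).const_mul _

/-- The truncation `max t 0` freezes the process at negative times and keeps `1 + ouClock` positive,
so that paths are continuous on the whole line. -/
lemma continuous_ouProcess (hlam : 0 < lam) (ω : Ω) :
    Continuous fun t => ouProcess lam ξ t ω := by
  have h := continuous_bridge (ξ := ξ) ω
  have h1 : Continuous fun t : ℝ => ouClock lam (max t 0) := by fun_prop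
  have h2 : ∀ t : ℝ, 1 + ouClock lam (max t 0) ≠ 0 := fun t =>
    (add_pos_of_pos_of_nonneg one_pos (ouClock_nonneg hlam (le_max_right _ _))).ne'
  have h3 := h.comp (h1.div₀ (continuous_const.add h1) h2)
  simp only [Function.comp_def] at h3
  unfold ouProcess
  fun_prop

lemma ouProcess_isGaussianProcess [IsProbabilityMeasure P] (hξ : IsWhiteNoise ξ P) :
    IsGaussianProcess (ouProcess lam ξ) P :=
  ((bridge_isGaussianProcess_and_covariance hξ).1.comp_right
    fun t => ouClock lam (max t 0) / (1 + ouClock lam (max t 0))).smul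
    fun t => Real.exp (-(lam * max t 0)) * (1 + ouClock lam (max t 0))

lemma integral_ouProcess [IsProbabilityMeasure P] (hξ : IsWhiteNoise ξ P) (t : ℝ) :
    P[ouProcess lam ξ t] = 0 := by
  have h := (bridge_isGaussianProcess_and_covariance hξ).2.1
  unfold ouProcess
  rw [integral_const_mul, h, mul_zero]

/-- With `σ ≤ τ` the two clock values, `(1 + σ)(1 + τ) · σ/(1 + σ) · (1 - τ/(1 + τ)) = σ`, the
covariance of Brownian motion. The exponential prefactors turn it into `ouCov`. -/
lemma covariance_ouProcess [IsProbabilityMeasure P] (hξ : IsWhiteNoise ξ P) (hlam : 0 < lam)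
    {s t : ℝ} (hs : 0 ≤ s) (ht : 0 ≤ t) :
    cov[ouProcess lam ξ s, ouProcess lam ξ t; P] = ouCov lam s t := by
  wlog h : s ≤ t generalizing s t
  · rw [covariance_comm, this ht hs (le_of_not_ge h), ouCov_comm]
  have hb := (bridge_isGaussianProcess_and_covariance hξ).2.2
  have hτs := ouClock_nonneg hlam hs
  have hτt := ouClock_nonneg hlam ht
  have hτ := ouClock_mono hlam h
  unfold ouProcess
  rw [covariance_const_mul_left, covariance_const_mul_right, hb, max_eq_left hs, max_eq_left ht,
    bridgeCov_of_le, clamp_of_mem (by positivity) (div_le_one_of_le₀ (by linarith) (by linarith)),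
    clamp_of_mem (by positivity) (div_le_one_of_le₀ (by linarith) (by linarith)), ouCov_of_le h,
    show -(lam * (t + s)) = -(lam * s) + -(lam * t) by ring, Real.exp_add]
  · have e : Real.exp (2 * lam * s) - 1 = 2 * lam * ouClock lam s := by
      unfold ouClock
      field_simp
    rw [e]
    field_simp
    ring
  · rw [div_le_div_iff₀ (by linarith) (by linarith)]
    nlinarith

end OrnsteinUhlenbeck

end BernsteinOU

/-! ### The driving noise is a Brownian motion. -/

namespace BernsteinOU

lemma ouCov_self_le {lam t : ℝ} (hlam : 0 < lam) : ouCov lam t t ≤ 1 / (2 * lam) := by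
  rw [ouCov_of_le le_rfl, div_mul_eq_mul_div]
  gcongr
  rw [mul_sub, ← Real.exp_add, mul_one, show -(lam * (t + t)) + 2 * lam * t = 0 by ring,
    Real.exp_zero]
  linarith [Real.exp_pos (-(lam * (t + t)))]

lemma continuous_ouCov {lam s : ℝ} : Continuous (ouCov lam s) := by
  unfold ouCov
  fun_prop

/-- The covariance of the Ornstein-Uhlenbeck process with its driving noise at a later time. -/
lemma ouCov_add_integral {lam u t : ℝ} (hlam : 0 < lam) (hu : 0 ≤ u) (hut : u ≤ t) :
    ouCov lam u t + lam * ∫ r in (0 : ℝ)..t, ouCov lam u r = (1 - Real.exp (-(lam * u))) / lam := by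
  have hlam' := hlam.ne'
  -- The integral is split at `u`, where the minimum in `ouCov` changes branch; each piece has an
  -- explicit primitive.
  have h1 : ∫ r in (0 : ℝ)..u, ouCov lam u r =
      Real.exp (-(lam * u)) * (Real.exp (lam * u) + Real.exp (-(lam * u))) / (2 * lam ^ 2) -
        Real.exp (-(lam * u)) * (Real.exp (lam * 0) + Real.exp (-(lam * 0))) / (2 * lam ^ 2) := by
    refine intervalIntegral.integral_eq_sub_of_hasDerivAt
      (f := fun r => Real.exp (-(lam * u)) * (Real.exp (lam * r) + Real.exp (-(lam * r))) /
        (2 * lam ^ 2)) (fun r hr => ?_) (continuous_ouCov.intervalIntegrable _ _)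
    rw [Set.uIcc_of_le hu] at hr
    have d1 : HasDerivAt (fun r => Real.exp (lam * r)) (Real.exp (lam * r) * lam) r := by
      simpa using ((hasDerivAt_id r).const_mul lam).exp
    have d2 : HasDerivAt (fun r => Real.exp (-(lam * r))) (Real.exp (-(lam * r)) * -lam) r := by
      simpa using ((hasDerivAt_id r).const_mul lam).neg.exp
    refine (((d1.add d2).const_mul (Real.exp (-(lam * u)))).div_const _).congr_deriv ?_
    rw [ouCov_comm, ouCov_of_le hr.2, show -(lam * (u + r)) = -(lam * u) + -(lam * r) by ring,
      show 2 * lam * r = lam * r + lam * r by ring, Real.exp_add, Real.exp_add,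
      Real.exp_neg (lam * r)]
    field_simp
    ring
  have h2 : ∫ r in u..t, ouCov lam u r =
      -(Real.exp (-(lam * (t + u))) * (Real.exp (2 * lam * u) - 1)) / (2 * lam ^ 2) -
        -(Real.exp (-(lam * (u + u))) * (Real.exp (2 * lam * u) - 1)) / (2 * lam ^ 2) := by
    refine intervalIntegral.integral_eq_sub_of_hasDerivAt
      (f := fun r => -(Real.exp (-(lam * (r + u))) * (Real.exp (2 * lam * u) - 1)) /
        (2 * lam ^ 2)) (fun r hr => ?_) (continuous_ouCov.intervalIntegrable _ _)
    rw [Set.uIcc_of_le hut] at hr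
    have d1 : HasDerivAt (fun r => Real.exp (-(lam * (r + u))))
        (Real.exp (-(lam * (r + u))) * -lam) r := by
      simpa using (((hasDerivAt_id r).add_const u).const_mul lam).neg.exp
    refine ((d1.mul_const (Real.exp (2 * lam * u) - 1)).neg.div_const _).congr_deriv ?_
    rw [ouCov_of_le hr.1]
    field_simp
  rw [← intervalIntegral.integral_add_adjacent_intervals
    (continuous_ouCov.intervalIntegrable 0 u) (continuous_ouCov.intervalIntegrable u t), h1, h2,
    ouCov_of_le hut, show -(lam * (u + u)) = -(lam * u) + -(lam * u) by ring,
    show 2 * lam * u = lam * u + lam * u by ring, Real.exp_add (lam * u), Real.exp_add (-(lam * u)),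
    Real.exp_neg (lam * u)]
  simp only [mul_zero, neg_zero, Real.exp_zero]
  field_simp
  ring

section OrnsteinUhlenbeck

variable {Ω : Type*} {mΩ : MeasurableSpace Ω} {P : Measure Ω} {ξ : (_ : ℕ) × ℕ → Ω → ℝ} {lam : ℝ}

open Filter Topology in
lemma ouNoise_isGaussianProcess [IsProbabilityMeasure P] (hξ : IsWhiteNoise ξ P)
    (hlam : 0 < lam) :
    IsGaussianProcess (ouNoise lam ξ) P ∧ ∀ t, P[ouNoise lam ξ t] = 0 := by
  have hX := ouProcess_isGaussianProcess (lam := lam) hξ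
  have h := IsGaussianProcess.of_ae_tendsto (P := P)
    -- The indices `k ≤ n` form a left Riemann sum of `lam ∫ X`. The extra index `k = n + 1` falls
    -- at time `t` with weight 1 and supplies the term `X_t`, so one finite combination approximates
    -- the whole noise.
    (X := fun (n : ℕ) (t : ℝ≥0) ω => ∑ k ∈ Finset.range (n + 1 + 1),
      (if k = n + 1 then 1 else lam * (t / (n + 1))) * ouProcess lam ξ (t * k / (n + 1)) ω)
    (Y := ouNoise lam ξ)
    (fun n => hX.sum_mul (fun _ => Finset.range (n + 1 + 1))
      (fun (t : ℝ≥0) k => if k = n + 1 then 1 else lam * (t / (n + 1))) fun t k => t * k / (n + 1))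
    (fun n t => by
      rw [integral_finsetSum _ fun k _ => (hX.hasGaussianLaw_eval _).integrable.const_mul _]
      exact Finset.sum_eq_zero fun k _ => by
        rw [integral_const_mul, integral_ouProcess hξ, mul_zero])
    (fun t => .of_forall fun ω => by
      have hR := (tendsto_left_riemann_sum (continuous_ouProcess (ξ := ξ) hlam ω)
        t.coe_nonneg).const_mul lam
      refine (hR.const_add (ouProcess lam ξ t ω)).congr fun n => ?_
      rw [Finset.sum_range_succ _ (n + 1), add_comm (ouProcess lam ξ t ω)]
      congr 1
      · rw [← mul_assoc, Finset.mul_sum]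
        refine Finset.sum_congr rfl fun k hk => ?_
        rw [if_neg (Finset.mem_range.1 hk).ne]
      · have : (t : ℝ) * ((n + 1 : ℕ) : ℝ) / (n + 1) = t := by
          push_cast
          field_simp
        rw [if_pos rfl, this, one_mul])
  exact ⟨h.1, h.2.1⟩

lemma memLp_two_ouProcess [IsProbabilityMeasure P] (hξ : IsWhiteNoise ξ P) (t : ℝ) :
    MemLp (ouProcess lam ξ t) 2 P :=
  ((ouProcess_isGaussianProcess hξ).hasGaussianLaw_eval t).memLp_two

lemma integral_ouProcess_mul [IsProbabilityMeasure P] (hξ : IsWhiteNoise ξ P) (hlam : 0 < lam)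
    {s t : ℝ} (hs : 0 ≤ s) (ht : 0 ≤ t) :
    ∫ ω, ouProcess lam ξ s ω * ouProcess lam ξ t ω ∂P = ouCov lam s t := by
  rw [← covariance_ouProcess hξ hlam hs ht,
    covariance_eq_sub (memLp_two_ouProcess hξ s) (memLp_two_ouProcess hξ t),
    integral_ouProcess hξ, zero_mul, sub_zero]
  rfl

/-- Fubini's theorem reduces expectations against the noise to expectations against the process,
where `ouCov` is known. It is used first with `Y` a value of the process, then with `Y` a value of
the noise. -/
lemma integral_mul_ouNoise [IsProbabilityMeasure P] (hξ : IsWhiteNoise ξ P) (hlam : 0 < lam)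
    {Y : Ω → ℝ} (mY : Measurable Y) (hY : MemLp Y 2 P) (t : ℝ≥0) :
    ∫ ω, Y ω * ouNoise lam ξ t ω ∂P = ∫ ω, Y ω * ouProcess lam ξ t ω ∂P +
      lam * ∫ r in (0 : ℝ)..t, ∫ ω, Y ω * ouProcess lam ξ r ω ∂P := by
  obtain ⟨h1, h2⟩ := integral_mul_intervalIntegral_eq mY hY
    (measurable_ouProcess (lam := lam) hξ) (continuous_ouProcess hlam)
    (memLp_two_ouProcess hξ) t.coe_nonneg (C := 1 / (2 * lam)) fun r hr => by
      simp_rw [sq]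
      rw [integral_ouProcess_mul hξ hlam hr.1 hr.1]
      exact ouCov_self_le hlam
  have e : ∀ ω, Y ω * ouNoise lam ξ t ω = Y ω * ouProcess lam ξ t ω +
      lam * (Y ω * ∫ r in (0 : ℝ)..t, ouProcess lam ξ r ω) := fun ω => by
    rw [ouNoise]
    ring
  simp_rw [e]
  have h3 : Integrable (fun ω => Y ω * ouProcess lam ξ t ω) P :=
    hY.integrable_mul (memLp_two_ouProcess hξ t)
  rw [integral_add h3 (h1.const_mul lam),
    integral_const_mul]
  exact congrArg _ (congrArg _ h2)

lemma integral_ouProcess_mul_ouNoise [IsProbabilityMeasure P] (hξ : IsWhiteNoise ξ P)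
    (hlam : 0 < lam) {u : ℝ} {t : ℝ≥0} (hu : 0 ≤ u) (hut : u ≤ t) :
    ∫ ω, ouProcess lam ξ u ω * ouNoise lam ξ t ω ∂P = (1 - Real.exp (-(lam * u))) / lam := by
  rw [integral_mul_ouNoise hξ hlam (measurable_ouProcess hξ u) (memLp_two_ouProcess hξ u),
    integral_ouProcess_mul hξ hlam hu t.coe_nonneg, ← ouCov_add_integral hlam hu hut]
  congr 2
  refine intervalIntegral.integral_congr fun r hr => ?_
  rw [Set.uIcc_of_le t.coe_nonneg] at hr
  exact integral_ouProcess_mul hξ hlam hu hr.1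

lemma continuous_ouNoise (hlam : 0 < lam) (ω : Ω) : Continuous fun t => ouNoise lam ξ t ω := by
  have h := continuous_ouProcess (ξ := ξ) hlam ω
  have h1 : Continuous fun t : ℝ => ∫ r in (0 : ℝ)..t, ouProcess lam ξ r ω :=
    intervalIntegral.continuous_primitive (fun a b => h.intervalIntegrable a b) 0
  unfold ouNoise
  exact (h.comp NNReal.continuous_coe).add
    (continuous_const.mul (h1.comp NNReal.continuous_coe))

lemma measurable_ouNoise (hξ : IsWhiteNoise ξ P) (hlam : 0 < lam) (t : ℝ≥0) :
    Measurable (ouNoise lam ξ t) := by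
  have hm : Measurable (Function.uncurry (ouProcess lam ξ)) :=
    (stronglyMeasurable_uncurry_of_continuous_of_stronglyMeasurable (continuous_ouProcess hlam)
      fun r => (measurable_ouProcess hξ r).stronglyMeasurable).measurable
  have h : Measurable fun ω => ∫ r in (0 : ℝ)..t, ouProcess lam ξ r ω := by
    simp_rw [intervalIntegral.integral_of_le t.coe_nonneg]
    exact (hm.comp measurable_swap).stronglyMeasurable.integral_prod_right'.measurable
  exact (measurable_ouProcess hξ t).add (h.const_mul lam)

/-- The driving noise of the Ornstein-Uhlenbeck process is a Brownian motion. -/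
theorem isBrownianReal_ouNoise [IsProbabilityMeasure P] (hξ : IsWhiteNoise ξ P)
    (hlam : 0 < lam) : IsBrownianReal (ouNoise lam ξ) P where
  toIsPreBrownianReal := by
    obtain ⟨hg, h0⟩ := ouNoise_isGaussianProcess hξ hlam
    have hL2 : ∀ t, MemLp (ouNoise lam ξ t) 2 P := fun t => (hg.hasGaussianLaw_eval t).memLp_two
    refine hg.isPreBrownianReal_of_covariance h0 fun s t hst => ?_
    have hst' : (s : ℝ) ≤ t := hst
    rw [covariance_eq_sub (hL2 s) (hL2 t), h0, zero_mul, sub_zero]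
    -- The noise at the earlier time `s` is the one expanded, so only process values at times `r ≤ s
    -- ≤ t` meet the noise at time `t`. The result is `(1 - e^{-lam s}) / lam + ∫_0^s (1 - e^{-lam
    -- r}) dr = s`.
    have e : (∫ ω, (ouNoise lam ξ s * ouNoise lam ξ t) ω ∂P) =
        ∫ ω, ouNoise lam ξ t ω * ouNoise lam ξ s ω ∂P := by
      simp_rw [Pi.mul_apply, mul_comm]
    rw [e, integral_mul_ouNoise hξ hlam (measurable_ouNoise hξ hlam t) (hL2 t)]
    simp_rw [mul_comm (ouNoise lam ξ t _)]
    rw [integral_ouProcess_mul_ouNoise hξ hlam s.coe_nonneg hst]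
    have h1 : ∫ r in (0 : ℝ)..s, ∫ ω, ouProcess lam ξ r ω * ouNoise lam ξ t ω ∂P =
        ∫ r in (0 : ℝ)..s, (1 - Real.exp (-(lam * r))) / lam := by
      refine intervalIntegral.integral_congr fun r hr => ?_
      rw [Set.uIcc_of_le s.coe_nonneg] at hr
      exact integral_ouProcess_mul_ouNoise hξ hlam hr.1 (hr.2.trans hst)
    have h2 : ∫ r in (0 : ℝ)..s, (1 - Real.exp (-(lam * r))) / lam =
        (s + Real.exp (-(lam * s)) / lam) / lam - (0 + Real.exp (-(lam * 0)) / lam) / lam := by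
      refine intervalIntegral.integral_eq_sub_of_hasDerivAt
        (f := fun r => (r + Real.exp (-(lam * r)) / lam) / lam) (fun r hr => ?_)
        (Continuous.intervalIntegrable (by fun_prop) _ _)
      have d2 : HasDerivAt (fun r => Real.exp (-(lam * r))) (Real.exp (-(lam * r)) * -lam) r := by
        simpa using ((hasDerivAt_id r).const_mul lam).neg.exp
      refine (((hasDerivAt_id r).add (d2.div_const lam)).div_const lam).congr_deriv ?_
      field_simp
      ring
    rw [h1, h2]
    simp only [mul_zero, neg_zero, Real.exp_zero]
    field_simp
    ring
  cont := .of_forall fun ω => continuous_ouNoise hlam ω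

lemma ouProcess_zero_ae_eq [IsProbabilityMeasure P] (hξ : IsWhiteNoise ξ P) (hlam : 0 < lam) :
    ∀ᵐ ω ∂P, ouProcess lam ξ 0 ω = 0 := by
  have h := (isBrownianReal_ouNoise hξ hlam).eval_zero_ae_eq_zero
  filter_upwards [h] with ω hω
  simpa [ouNoise] using hω

theorem isOrnsteinUhlenbeckFromZero_ouProcess [IsProbabilityMeasure P] (hξ : IsWhiteNoise ξ P)
    (hlam : 0 < lam) (T : ℝ) :
    IsOrnsteinUhlenbeckFromZero lam T (ouProcess lam ξ) P := by
  refine ⟨ouNoise lam ξ, isBrownianReal_ouNoise hξ hlam, ?_⟩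
  filter_upwards [ouProcess_zero_ae_eq hξ hlam] with ω hω
  refine ⟨(continuous_ouProcess hlam ω).continuousOn, hω, fun t ht => ?_⟩
  rw [ouNoise, Real.coe_toNNReal _ ht.1]
  ring

end OrnsteinUhlenbeck

end BernsteinOU

/-! ### Non-stationarity and independent components. -/

namespace BernsteinOU

lemma not_isStationaryOn_ouProcess {Ω : Type*} {mΩ : MeasurableSpace Ω} {P : Measure Ω}
    [IsProbabilityMeasure P] {ξ : (_ : ℕ) × ℕ → Ω → ℝ} (hξ : IsWhiteNoise ξ P) {lam T : ℝ}
    (hlam : 0 < lam) (hT : 0 < T) : ¬ IsStationaryOn T (ouProcess lam ξ) P := by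
  intro h
  -- Shifting the single time 0 by `T` is enough: the variance vanishes at 0 and is positive at `T`.
  have h1 := h 1 (fun _ => 0) T (fun _ => ⟨le_rfl, hT.le⟩) fun _ => by simp [hT.le]
  have hm := measurable_ouProcess (lam := lam) hξ
  have hid : IdentDistrib (fun ω (_ : Fin 1) => ouProcess lam ξ (0 + T) ω)
      (fun ω (_ : Fin 1) => ouProcess lam ξ 0 ω) P P :=
    ⟨by have := hm (0 + T); fun_prop, by have := hm 0; fun_prop, h1⟩
  have hvar := (hid.comp (measurable_pi_apply 0)).variance_eq
  change Var[ouProcess lam ξ (0 + T); P] = Var[ouProcess lam ξ 0; P] at hvar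
  rw [zero_add, ← covariance_self (hm _).aemeasurable, ← covariance_self (hm _).aemeasurable,
    covariance_ouProcess hξ hlam hT.le hT.le, covariance_ouProcess hξ hlam le_rfl le_rfl,
    ouCov_of_le le_rfl, ouCov_of_le le_rfl] at hvar
  have hpos : 0 < Real.exp (2 * lam * T) - 1 := sub_pos.2 (Real.one_lt_exp_iff.2 (by positivity))
  have : 0 < Real.exp (-(lam * (T + T))) / (2 * lam) * (Real.exp (2 * lam * T) - 1) := by
    positivity
  simp at hvar
  rcases hvar with hvar | hvar <;> linarith

/-- Countably many white noises on a product space. -/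
lemma isWhiteNoise_pi {ι S : Type*} [Fintype ι] (i : ι) :
    IsWhiteNoise (fun (p : S) (ω : ι → S → ℝ) => ω i p)
      (Measure.pi fun _ : ι => Measure.infinitePi fun _ : S => gaussianReal 0 1) := by
  have hmap : (Measure.pi fun _ : ι => Measure.infinitePi fun _ : S => gaussianReal 0 1).map
      (fun ω => ω i) = Measure.infinitePi fun _ : S => gaussianReal 0 1 :=
    (measurePreserving_eval (fun _ : ι => Measure.infinitePi fun _ : S => gaussianReal 0 1) i).map_eq
  have hlaw : ∀ p : S, (Measure.pi fun _ : ι =>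
      Measure.infinitePi fun _ : S => gaussianReal 0 1).map (fun ω => ω i p) =
      gaussianReal 0 1 := by
    intro p
    have h := (isWhiteNoise_infinitePi S).law p
    rwa [← hmap, Measure.map_map (by fun_prop) (by fun_prop)] at h
  refine ⟨fun p => by fun_prop, hlaw, ?_⟩
  rw [iIndepFun_iff_map_fun_eq_infinitePi_map (fun p => by fun_prop)]
  simp_rw [hlaw]
  exact hmap

/-- Independent copies of a Gaussian process form a Gaussian process. -/
theorem isGaussianProcess_of_iIndepFun {ι Ω S : Type*} [Finite ι] {mΩ : MeasurableSpace Ω}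
    {P : Measure Ω} {X : ι → S → Ω → ℝ} (hX : ∀ i, IsGaussianProcess (X i) P)
    (hind : iIndepFun (fun i ω t => X i t ω) P) :
    IsGaussianProcess (fun (p : ι × S) ω => X p.1 p.2 ω) P where
  hasGaussianLaw I := by
    classical
    have := Fintype.ofFinite ι
    -- The index set is enlarged to the full rectangle `ι × J`, on which independence of the
    -- components gives a joint Gaussian law; the required family is a projection.
    set J : Finset S := I.image Prod.snd
    have h1 : iIndepFun (fun i ω => J.restrict (X i · ω)) P :=
      hind.comp (fun _ => J.restrict) fun _ => Finset.measurable_restrict J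
    have h2 := h1.hasGaussianLaw fun i => (hX i).hasGaussianLaw J
    exact h2.map_fun (ContinuousLinearMap.pi fun p : I =>
      (ContinuousLinearMap.proj (R := ℝ) (φ := fun _ : J => ℝ)
        ⟨p.1.2, Finset.mem_image_of_mem _ p.2⟩).comp
        (ContinuousLinearMap.proj (R := ℝ) (φ := fun _ : ι => J → ℝ) p.1.1))

/-- Existence of a process whose components are independent Ornstein-Uhlenbeck processes. -/
theorem exists_ornsteinUhlenbeck (N : ℕ) {lam T : ℝ} (hlam : 0 < lam) (hT : 0 < T) :
    ∃ (Ω' : Type) (_ : MeasurableSpace Ω') (P' : Measure Ω') (X : ℝ → Ω' → Space N),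
      IsProbabilityMeasure P' ∧ (∀ t, Measurable (X t)) ∧
      iIndepFun (fun (i : Fin N) (ω : Ω') (t : ℝ) => X t ω i) P' ∧
      (∀ i : Fin N, IsOrnsteinUhlenbeckFromZero lam T (fun t ω => X t ω i) P' ∧
        ¬ IsStationaryOn T (fun t ω => X t ω i) P') ∧
      IsGaussianProcess (fun (p : Fin N × ℝ) ω => X p.2 ω p.1) P' ∧
      (∀ i t, ∫ ω, X t ω i ∂P' = 0) ∧
      ∀ i j s t, 0 ≤ s → 0 ≤ t → cov[fun ω => X s ω i, fun ω => X t ω j; P'] =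
        ouCov lam s t * if i = j then 1 else 0 := by
  set ξ : Fin N → (_ : ℕ) × ℕ → (Fin N → (_ : ℕ) × ℕ → ℝ) → ℝ := fun i p ω => ω i p
  set P' : Measure (Fin N → (_ : ℕ) × ℕ → ℝ) :=
    Measure.pi fun _ => Measure.infinitePi fun _ => gaussianReal 0 1
  have hξ : ∀ i, IsWhiteNoise (ξ i) P' := fun i => isWhiteNoise_pi i
  have hm : ∀ i t, Measurable (ouProcess lam (ξ i) t) := fun i => measurable_ouProcess (hξ i)
  have hind : iIndepFun (fun (i : Fin N) ω (t : ℝ) => ouProcess lam (ξ i) t ω) P' :=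
    iIndepFun_pi (X := fun (_ : Fin N) (ω : (_ : ℕ) × ℕ → ℝ) (t : ℝ) =>
      ouProcess lam (fun p (ω : (_ : ℕ) × ℕ → ℝ) => ω p) t ω) fun i =>
      (measurable_pi_lambda _ fun t =>
        measurable_ouProcess (isWhiteNoise_infinitePi ((_ : ℕ) × ℕ)) t).aemeasurable
  refine ⟨_, inferInstance, P', fun t ω => WithLp.toLp 2 fun i => ouProcess lam (ξ i) t ω,
    inferInstance, fun t => ?_, hind, fun i =>
      ⟨isOrnsteinUhlenbeckFromZero_ouProcess (hξ i) hlam T,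
        not_isStationaryOn_ouProcess (hξ i) hlam hT⟩,
    isGaussianProcess_of_iIndepFun (fun i => ouProcess_isGaussianProcess (hξ i)) hind,
    fun i t => integral_ouProcess (hξ i) t, fun i j s t hs ht => ?_⟩
  · have := fun i => hm i t
    fun_prop
  · by_cases hij : i = j
    · subst hij
      simpa using covariance_ouProcess (hξ i) hlam hs ht
    · have h := (hind.indepFun hij).comp (measurable_pi_apply s) (measurable_pi_apply t)
      have h0 : cov[ouProcess lam (ξ i) s, ouProcess lam (ξ j) t; P'] = 0 :=
        IndepFun.covariance_eq_zero h (memLp_two_ouProcess (hξ i) s)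
          (memLp_two_ouProcess (hξ j) t)
      rw [if_neg hij, mul_zero]
      exact h0

end BernsteinOU

/-! ### Mehler's kernel: Gaussian transitions and boundary laws. -/

namespace BernsteinOU

variable {N : ℕ} {lam : ℝ}

/-- The weight of the later endpoint in the mean of the Bernstein transition. -/
noncomputable def lateWeight (lam s r t : ℝ) : ℝ :=
  Real.sinh (lam * (r - s)) / Real.sinh (lam * (t - s))

/-- The weight of the earlier endpoint in the mean of the Bernstein transition. -/
noncomputable def earlyWeight (lam s r t : ℝ) : ℝ :=
  Real.sinh (lam * (t - r)) / Real.sinh (lam * (t - s))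

/-- The variance of the Bernstein transition. -/
noncomputable def transitionVar (lam s r t : ℝ) : ℝ :=
  Real.sinh (lam * (t - r)) * Real.sinh (lam * (r - s)) / (lam * Real.sinh (lam * (t - s)))

lemma sinh_mul_sub_pos (hlam : 0 < lam) {s t : ℝ} (h : s < t) : 0 < Real.sinh (lam * (t - s)) :=
  Real.sinh_pos_iff.2 (mul_pos hlam (sub_pos.2 h))

lemma transitionVar_pos (hlam : 0 < lam) {s r t : ℝ} (hsr : s < r) (hrt : r < t) :
    0 < transitionVar lam s r t :=
  div_pos (mul_pos (sinh_mul_sub_pos hlam hrt) (sinh_mul_sub_pos hlam hsr))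
    (mul_pos hlam (sinh_mul_sub_pos hlam (hsr.trans hrt)))

/-- The Bernstein density built from Mehler's kernel is Gaussian. -/
lemma bernsteinDensity_mehlerKernel (hlam : 0 < lam) {s r t : ℝ} (hsr : s < r) (hrt : r < t)
    (x z y : Space N) :
    bernsteinDensity (mehlerKernel N lam) x t z r y s = isoGaussianPDF N (transitionVar lam s r t)
      (z - (lateWeight lam s r t • x + earlyWeight lam s r t • y)) := by
  have p1 := sinh_mul_sub_pos hlam hrt
  have p2 := sinh_mul_sub_pos hlam hsr
  have p3 := sinh_mul_sub_pos hlam (hsr.trans hrt)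
  have hS : Real.sinh (lam * (t - s)) = Real.sinh (lam * (t - r)) * Real.cosh (lam * (r - s)) +
      Real.cosh (lam * (t - r)) * Real.sinh (lam * (r - s)) := by
    rw [← Real.sinh_add]; congr 1; ring
  have hC : Real.cosh (lam * (t - s)) = Real.cosh (lam * (t - r)) * Real.cosh (lam * (r - s)) +
      Real.sinh (lam * (t - r)) * Real.sinh (lam * (r - s)) := by
    rw [← Real.cosh_add]; congr 1; ring
  have q1 := Real.cosh_sq (lam * (t - r))
  have q2 := Real.cosh_sq (lam * (r - s))
  have hnorm : ∀ a b : ℝ, ‖z - (a • x + b • y)‖ ^ 2 = ‖z‖ ^ 2 + a ^ 2 * ‖x‖ ^ 2 + b ^ 2 * ‖y‖ ^ 2 -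
      2 * a * inner ℝ x z - 2 * b * inner ℝ z y + 2 * a * b * inner ℝ x y := by
    intro a b
    rw [norm_sub_sq_real, norm_add_sq_real, inner_add_right, real_inner_smul_right,
      real_inner_smul_right, real_inner_smul_left, real_inner_smul_right, norm_smul, norm_smul,
      mul_pow, mul_pow, Real.norm_eq_abs, Real.norm_eq_abs, sq_abs, sq_abs, real_inner_comm x z]
    ring
  unfold bernsteinDensity mehlerKernel isoGaussianPDF
  rw [hnorm]
  unfold lateWeight earlyWeight transitionVar
  set S1 := Real.sinh (lam * (t - r))
  set S2 := Real.sinh (lam * (r - s))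
  set S3 := Real.sinh (lam * (t - s))
  set C1 := Real.cosh (lam * (t - r))
  set C2 := Real.cosh (lam * (r - s))
  set C3 := Real.cosh (lam * (t - s))
  -- These are the subtraction formulas for `sinh`. Together with `hS` they match the coefficients
  -- of `‖x‖ ^ 2`, `‖y‖ ^ 2` and `‖z‖ ^ 2` when the square is completed; the inner products match
  -- directly.
  have e1 : C1 * S3 - C3 * S1 = S2 := by
    rw [hS, hC]; linear_combination S2 * q1
  have e2 : C2 * S3 - C3 * S2 = S1 := by
    rw [hS, hC]; linear_combination S1 * q2
  have hpow : (lam / (2 * Real.pi * S1)) ^ ((N : ℝ) / 2) *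
      (lam / (2 * Real.pi * S2)) ^ ((N : ℝ) / 2) / (lam / (2 * Real.pi * S3)) ^ ((N : ℝ) / 2) =
      (2 * Real.pi * (S1 * S2 / (lam * S3))) ^ (-((N : ℝ) / 2)) := by
    rw [← Real.mul_rpow (by positivity) (by positivity), ← Real.div_rpow (by positivity)
      (by positivity), Real.rpow_neg (by positivity), ← Real.inv_rpow (by positivity)]
    congr 1
    field_simp
  rw [← hpow, mul_mul_mul_comm, mul_div_mul_comm, ← Real.exp_add, ← Real.exp_sub]
  congr 2
  field_simp
  rw [← sub_eq_zero]
  generalize (inner ℝ x z : ℝ) = xz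
  generalize (inner ℝ z y : ℝ) = zy
  generalize (inner ℝ x y : ℝ) = xy
  generalize ‖x‖ = nx
  generalize ‖y‖ = ny
  generalize ‖z‖ = nz
  linear_combination (-(S2 * nx ^ 2)) * e1 - S1 * ny ^ 2 * e2 + S3 * nz ^ 2 * hS

lemma bernsteinTransition_mehlerKernel (hlam : 0 < lam) {s r t : ℝ} (hsr : s < r) (hrt : r < t)
    (x y : Space N) {A : Set (Space N)} (hA : MeasurableSet A) :
    bernsteinTransition (mehlerKernel N lam) x t A r y s =
      (isoGaussian N (transitionVar lam s r t)).real
        ((fun z => lateWeight lam s r t • x + earlyWeight lam s r t • y + z) ⁻¹' A) := by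
  set m := lateWeight lam s r t • x + earlyWeight lam s r t • y with hm
  rw [isoGaussian_real_apply (transitionVar_pos hlam hsr hrt) (measurable_const_add m hA),
    bernsteinTransition]
  simp_rw [bernsteinDensity_mehlerKernel hlam hsr hrt, ← hm]
  rw [← (measurePreserving_add_left volume m).setIntegral_preimage_emb
    (MeasurableEquiv.addLeft m).measurableEmbedding]
  simp

/-- The variance of the Ornstein-Uhlenbeck process started at the origin. -/
noncomputable def ouVar (lam t : ℝ) : ℝ := Real.sinh (lam * t) * Real.exp (-(lam * t)) / lam

lemma ouVar_pos (hlam : 0 < lam) {t : ℝ} (ht : 0 < t) : 0 < ouVar lam t :=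
  div_pos (mul_pos (Real.sinh_pos_iff.2 (mul_pos hlam ht)) (Real.exp_pos _)) hlam

lemma ouVar_eq_ouCov (hlam : 0 < lam) (t : ℝ) : ouVar lam t = ouCov lam t t := by
  rw [ouCov_of_le le_rfl, ouVar, Real.sinh_eq, show -(lam * (t + t)) = -(lam * t) + -(lam * t) by ring,
    show 2 * lam * t = lam * t + lam * t by ring, Real.exp_add, Real.exp_add, Real.exp_neg]
  field_simp

/-- The product of the kernel with the boundary data is a Gaussian density. -/
lemma mehlerKernel_mul_data (hlam : 0 < lam) {T : ℝ} (hT : 0 < T) (y : Space N) :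
    Real.exp (lam * T) ^ ((N : ℝ) / 4) * (mehlerKernel N lam 0 T y *
      (Real.exp (lam * T) ^ ((N : ℝ) / 4) * Real.exp (-(lam * ‖y‖ ^ 2 / 2)))) =
      isoGaussianPDF N (ouVar lam T) y := by
  have hS : 0 < Real.sinh (lam * T) := Real.sinh_pos_iff.2 (mul_pos hlam hT)
  have hexp : Real.exp (lam * T) = Real.cosh (lam * T) + Real.sinh (lam * T) :=
    (Real.cosh_add_sinh _).symm
  have hpow : Real.exp (lam * T) ^ ((N : ℝ) / 4) * Real.exp (lam * T) ^ ((N : ℝ) / 4) *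
      (lam / (2 * Real.pi * Real.sinh (lam * T))) ^ ((N : ℝ) / 2) =
      (2 * Real.pi * ouVar lam T) ^ (-((N : ℝ) / 2)) := by
    have hv := ouVar_pos hlam hT
    rw [← Real.rpow_add (Real.exp_pos _), show (N : ℝ) / 4 + (N : ℝ) / 4 = N / 2 by ring,
      ← Real.mul_rpow (by positivity) (by positivity), Real.rpow_neg (by positivity),
      ← Real.inv_rpow (by positivity)]
    congr 1
    rw [ouVar, Real.exp_neg]
    field_simp
  rw [isoGaussianPDF, ← hpow, mehlerKernel]
  -- At `x = 0` the cross term disappears, and the final datum adds 1 to `cosh / sinh`, giving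
  -- `e^{lam T} / sinh(lam T)`, which is `1 / (lam * ouVar lam T)`.
  have e : Real.exp (-(lam * (Real.cosh (lam * T) * (‖(0 : Space N)‖ ^ 2 + ‖y‖ ^ 2) -
      2 * inner ℝ (0 : Space N) y) / (2 * Real.sinh (lam * T)))) * Real.exp (-(lam * ‖y‖ ^ 2 / 2)) =
      Real.exp (-(‖y‖ ^ 2 / (2 * ouVar lam T))) := by
    rw [← Real.exp_add, norm_zero, inner_zero_left, ouVar, Real.exp_neg (lam * T)]
    congr 1
    rw [hexp]
    have : Real.cosh (lam * T) + Real.sinh (lam * T) ≠ 0 := by rw [← hexp]; positivity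
    field_simp
    ring
  rw [← e]
  ring

lemma continuous_mehlerKernel (T : ℝ) :
    Continuous fun q : Space N × Space N => mehlerKernel N lam q.1 T q.2 := by
  unfold mehlerKernel
  fun_prop

/-- The joint law of the endpoints of the Bernstein process. -/
lemma markovianMeasure_mehlerKernel (hlam : 0 < lam) {T : ℝ} (hT : 0 < T) :
    markovianMeasure (mehlerKernel N lam) T (diracDatum N lam T) (gaussianDatum N lam T) =
      (isoGaussian N (ouVar lam T)).map (fun y => ((0 : Space N), y)) := by
  have hS : 0 < Real.sinh (lam * T) := Real.sinh_pos_iff.2 (mul_pos hlam hT)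
  have hg : Measurable fun q : Space N × Space N => ENNReal.ofReal (mehlerKernel N lam q.1 T q.2) :=
    (continuous_mehlerKernel T).measurable.ennreal_ofReal
  have hmk : Measurable fun y : Space N => ((0 : Space N), y) := measurable_prodMk_left
  have hgy : Measurable fun y : Space N => ENNReal.ofReal (mehlerKernel N lam 0 T y) := by
    unfold mehlerKernel
    fun_prop
  ext F hF
  rw [markovianMeasure, withDensity_apply _ hF, diracDatum, gaussianDatum, Measure.prod_smul_left,
    Measure.dirac_prod, Measure.restrict_smul, lintegral_smul_measure, setLIntegral_map hF hg hmk]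
  dsimp only
  rw [setLIntegral_withDensity_eq_setLIntegral_mul _ (by fun_prop) hgy (hmk hF),
    Measure.map_apply hmk hF, isoGaussian, withDensity_apply _ (hmk hF), smul_eq_mul,
    ← lintegral_const_mul _ (by fun_prop)]
  refine lintegral_congr fun y => ?_
  have hmul : ∀ {c k d : ℝ}, 0 ≤ c → 0 ≤ d → ENNReal.ofReal (c * (k * d)) =
      ENNReal.ofReal c * (ENNReal.ofReal d * ENNReal.ofReal k) := fun {c k d} hc hd => by
    rw [mul_comm k d, ENNReal.ofReal_mul hc, ENNReal.ofReal_mul hd]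
  rw [← mehlerKernel_mul_data hlam hT, hmul (by positivity) (by positivity), Pi.mul_apply]

end BernsteinOU

/-! ### Innovations and Gaussianity of the Bernstein process. -/

/-- The coordinates of a vector valued Gaussian process form a Gaussian process. -/
theorem ProbabilityTheory.IsGaussianProcess.coord {Ω S ι : Type*} [Fintype ι]
    {mΩ : MeasurableSpace Ω} {P : Measure Ω} {X : S → Ω → EuclideanSpace ℝ ι}
    (hX : IsGaussianProcess X P) : IsGaussianProcess (fun (p : ι × S) ω => X p.2 ω p.1) P :=
  hX.of_isGaussianProcess fun p => ⟨{p.2}, (EuclideanSpace.proj (𝕜 := ℝ) p.1).comp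
    (ContinuousLinearMap.proj (R := ℝ) (φ := fun _ : ({p.2} : Finset S) => EuclideanSpace ℝ ι)
      ⟨p.2, Finset.mem_singleton_self _⟩), fun _ => rfl⟩

namespace BernsteinOU

variable {N : ℕ} {lam T : ℝ} {Ω : Type*} {Z : ℝ → Ω → Space N}

/-- The information carried by `Z` up to time `s` and at time `T`. -/
abbrev pastEndSigma (T : ℝ) (Z : ℝ → Ω → Space N) (s : ℝ) : MeasurableSpace Ω :=
  pastSigma Z s ⊔ futureSigma T Z T

lemma measurable_pastSigma {s τ : ℝ} (hτ : τ ∈ Set.Icc 0 s) : Measurable[pastSigma Z s] (Z τ) := by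
  rw [measurable_iff_comap_le]
  exact le_iSup₂ (f := fun τ (_ : τ ∈ Set.Icc (0 : ℝ) s) =>
    MeasurableSpace.comap (Z τ) inferInstance) τ hτ

lemma measurable_pastEndSigma {s τ : ℝ} (hτ : τ ∈ Set.Icc 0 s) :
    Measurable[pastEndSigma T Z s] (Z τ) :=
  (measurable_pastSigma hτ).mono le_sup_left le_rfl

lemma measurable_pastEndSigma_end {s : ℝ} : Measurable[pastEndSigma T Z s] (Z T) := by
  rw [measurable_iff_comap_le]
  exact (le_iSup₂ (f := fun τ (_ : τ ∈ Set.Icc T T) =>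
    MeasurableSpace.comap (Z τ) inferInstance) T ⟨le_rfl, le_rfl⟩).trans le_sup_right

lemma pastSigma_le [mΩ : MeasurableSpace Ω]
    (hZ : ∀ t ∈ Set.Icc (0 : ℝ) T, Measurable (Z t)) {s : ℝ} (hs : s ≤ T) :
    pastSigma Z s ≤ mΩ :=
  iSup₂_le fun τ hτ => (hZ τ ⟨hτ.1, hτ.2.trans hs⟩).comap_le

lemma pastEndSigma_le [mΩ : MeasurableSpace Ω] (hT : 0 ≤ T)
    (hZ : ∀ t ∈ Set.Icc (0 : ℝ) T, Measurable (Z t)) {s : ℝ} (hs : s ≤ T) : pastEndSigma T Z s ≤ mΩ :=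
  sup_le (pastSigma_le hZ hs)
    (iSup₂_le fun τ hτ => (hZ τ ⟨hT.trans hτ.1, hτ.2⟩).comap_le)

/-- The innovation of the Bernstein process at time `r`, given its past until time `s` and its
value at time `T`. -/
noncomputable def innovation (lam T : ℝ) (Z : ℝ → Ω → Space N) (s r : ℝ) (ω : Ω) : Space N :=
  Z r ω - (lateWeight lam s r T • Z T ω + earlyWeight lam s r T • Z s ω)

variable [mΩ : MeasurableSpace Ω] {P : Measure Ω}

/-- `Z` is the Bernstein process associated with Mehler's kernel, the Dirac initial datum and the
Gaussian final datum. -/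
abbrev IsMehlerBernstein (lam T : ℝ) (Z : ℝ → Ω → Space N) (P : Measure Ω) : Prop :=
  IsAssociatedBernstein (mehlerKernel N lam) T (diracDatum N lam T) (gaussianDatum N lam T) Z P

namespace IsMehlerBernstein

/-- With later time `T` the future is generated by `Z T` alone. The conditional law of `Z r` is then
a Gaussian translated by a variable measurable for `pastEndSigma`, so
`indep_sub_of_condExp_indicator_eq` applies. -/
lemma innovation_law_and_indep [IsProbabilityMeasure P] (hlam : 0 < lam) (hT : 0 < T)
    (hZ : IsMehlerBernstein lam T Z P) {s r : ℝ} (hs : 0 ≤ s) (hsr : s < r) (hrT : r < T) :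
    P.map (innovation lam T Z s r) = isoGaussian N (transitionVar lam s r T) ∧
      Indep (MeasurableSpace.comap (innovation lam T Z s r) inferInstance)
        (pastEndSigma T Z s) P := by
  have hm := hZ.isBernstein.measurable
  have := isProbabilityMeasure_isoGaussian (N := N) (transitionVar_pos hlam hsr hrT)
  refine indep_sub_of_condExp_indicator_eq (Z := Z r) (pastEndSigma_le hT.le hm (hsr.trans hrT).le)
    (hm r ⟨hs.trans hsr.le, hrT.le⟩) ?_ fun A hA => ?_
  · have e : Measurable fun q : Space N × Space N =>
        lateWeight lam s r T • q.1 + earlyWeight lam s r T • q.2 := by fun_prop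
    exact e.comp (measurable_pastEndSigma_end.prodMk (measurable_pastEndSigma ⟨hs, le_rfl⟩))
  · have h1 := hZ.isBernstein.condExp_eq (A.indicator fun _ => (1 : ℝ))
      (measurable_const.indicator hA) ⟨1, fun x => by
        by_cases hx : x ∈ A <;> simp [hx]⟩ s r T hs hsr hrT le_rfl
    have h2 := hZ.transition A hA s r T hs hsr hrT le_rfl
    have e : (fun ω => A.indicator (fun _ => (1 : ℝ)) (Z r ω)) =
        (Z r ⁻¹' A).indicator fun _ => (1 : ℝ) := rfl
    rw [e] at h1
    refine (h1.trans h2).trans (.of_forall fun ω => ?_)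
    exact bernsteinTransition_mehlerKernel hlam hsr hrT _ _ hA

lemma measurable_innovation (hT : 0 < T) (hZ : IsMehlerBernstein lam T Z P)
    {s r : ℝ} (hs : 0 ≤ s) (hsr : s < r) (hrT : r < T) :
    Measurable (innovation lam T Z s r) := by
  have hm := hZ.isBernstein.measurable
  have mr := hm r ⟨hs.trans hsr.le, hrT.le⟩
  have mT := hm T ⟨hT.le, le_rfl⟩
  have ms := hm s ⟨hs, (hsr.trans hrT).le⟩
  have e : Measurable fun q : Space N × Space N × Space N =>
      q.1 - (lateWeight lam s r T • q.2.1 + earlyWeight lam s r T • q.2.2) := by fun_prop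
  exact e.comp (mr.prodMk (mT.prodMk ms))

lemma map_end (hlam : 0 < lam) (hT : 0 < T)
    (hZ : IsMehlerBernstein lam T Z P) : P.map (Z T) = isoGaussian N (ouVar lam T) := by
  have hm := hZ.isBernstein.measurable
  have h0 : Measurable (Z 0) := hm 0 ⟨le_rfl, hT.le⟩
  have hT' : Measurable (Z T) := hm T ⟨hT.le, le_rfl⟩
  have h := hZ.endpoints
  rw [markovianMeasure_mehlerKernel hlam hT] at h
  have h' := congrArg (Measure.map Prod.snd) h
  rw [Measure.map_map measurable_snd (h0.prodMk hT'),
    Measure.map_map measurable_snd measurable_prodMk_left] at h'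
  simpa [Function.comp_def] using h'

lemma ae_zero (hlam : 0 < lam) (hT : 0 < T)
    (hZ : IsMehlerBernstein lam T Z P) : ∀ᵐ ω ∂P, Z 0 ω = 0 := by
  have hm := hZ.isBernstein.measurable
  have h0 : Measurable (Z 0) := hm 0 ⟨le_rfl, hT.le⟩
  have hT' : Measurable (Z T) := hm T ⟨hT.le, le_rfl⟩
  have h := hZ.endpoints
  rw [markovianMeasure_mehlerKernel hlam hT] at h
  have h' : ∀ᵐ q ∂(P.map fun ω => (Z 0 ω, Z T ω)), q.1 = 0 := by
    rw [h, ae_map_iff measurable_prodMk_left.aemeasurable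
      (measurableSet_eq_fun measurable_fst measurable_const)]
    exact .of_forall fun _ => rfl
  exact ae_of_ae_map (h0.prodMk hT').aemeasurable h'

lemma hasGaussianLaw_insert [IsProbabilityMeasure P] (hlam : 0 < lam) (hT : 0 < T)
    (hZ : IsMehlerBernstein lam T Z P) (J : Finset ℝ) (hJ : ∀ t ∈ J, 0 < t ∧ t < T) :
    HasGaussianLaw (fun ω (t : ↥(insert 0 (insert T J))) => Z t ω) P := by
  induction J using Finset.induction_on_max with
  | empty =>
    have hv := ouVar_pos hlam hT
    have := isGaussian_isoGaussian (N := N) hv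
    have hg : HasGaussianLaw (Z T) P := ⟨by rw [map_end hlam hT hZ]; infer_instance⟩
    -- Since `Z 0` vanishes almost surely, the pair of endpoints is a linear image of `Z T`: the
    -- zero map at time 0 and the identity at time `T`.
    have h := hg.map_fun (ContinuousLinearMap.pi fun t : ↥(insert 0 (insert T (∅ : Finset ℝ))) =>
      if (t : ℝ) = 0 then 0 else ContinuousLinearMap.id ℝ (Space N))
    refine h.congr ?_
    filter_upwards [ae_zero hlam hT hZ] with ω hω
    ext1 ⟨t, ht⟩
    by_cases h0 : t = 0
    · change (if t = 0 then (0 : Space N →L[ℝ] Space N) else ContinuousLinearMap.id ℝ (Space N))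
        (Z T ω) = Z t ω
      simp [h0, hω]
    · change (if t = 0 then (0 : Space N →L[ℝ] Space N) else ContinuousLinearMap.id ℝ (Space N))
        (Z T ω) = Z t ω
      have : t = T := by simpa [h0] using ht
      rw [if_neg h0, this]
      rfl
  | insert r J hr ih =>
    have ih := ih fun t ht => hJ t (Finset.mem_insert_of_mem ht)
    obtain ⟨hr0, hrT⟩ := hJ r (Finset.mem_insert_self _ _)
    -- The new time `r` exceeds all earlier interior times, and `s` is the largest of these and 0.
    -- All values collected so far are thus measurable for `pastEndSigma T Z s`, hence independent
    -- of the innovation from `s` to `r`.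
    obtain ⟨s, hsJ, hs⟩ := (insert 0 J).exists_max_image id (Finset.insert_nonempty 0 J)
    have hs0 : 0 ≤ s := hs 0 (Finset.mem_insert_self _ _)
    have hsr : s < r := by
      rcases Finset.mem_insert.1 hsJ with rfl | h
      · exact hr0
      · exact hr s h
    have hv := transitionVar_pos hlam hsr hrT
    obtain ⟨hlaw, hind⟩ := innovation_law_and_indep hlam hT hZ hs0 hsr hrT
    have := isGaussian_isoGaussian (N := N) hv
    have hg : HasGaussianLaw (innovation lam T Z s r) P := ⟨by rw [hlaw]; infer_instance⟩
    set K : Finset ℝ := insert 0 (insert T J) with hK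
    have hTK : T ∈ K := by simp [hK]
    have hsK : s ∈ K := by
      rcases Finset.mem_insert.1 hsJ with rfl | h <;> simp [*]
    have hmeas : Measurable[pastEndSigma T Z s] fun ω (t : K) => Z t ω := by
      refine @measurable_pi_lambda _ _ _ (pastEndSigma T Z s) _ _ fun t => ?_
      rcases Finset.mem_insert.1 t.2 with h | h
      · rw [h]
        exact measurable_pastEndSigma ⟨le_rfl, hs0⟩
      rcases Finset.mem_insert.1 h with h | h
      · rw [h]
        exact measurable_pastEndSigma_end
      · exact measurable_pastEndSigma ⟨(hJ _ (Finset.mem_insert_of_mem h)).1.le,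
          hs _ (Finset.mem_insert_of_mem h)⟩
    have hindep : IndepFun (innovation lam T Z s r) (fun ω (t : K) => Z t ω) P :=
      indep_of_indep_of_le_right hind hmeas.comap_le
    have hpair := hindep.hasGaussianLaw hg ih
    have hmem : ∀ t ∈ insert 0 (insert T (insert r J)), t ≠ r → t ∈ K := by
      intro t ht htr
      simp only [Finset.mem_insert, hK] at ht ⊢
      tauto
    have h := hpair.map_fun (ContinuousLinearMap.pi
      fun t : ↥(insert 0 (insert T (insert r J))) =>
        if h : (t : ℝ) = r then
          ContinuousLinearMap.fst ℝ (Space N) (K → Space N) +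
          (lateWeight lam s r T • ContinuousLinearMap.proj (R := ℝ) (φ := fun _ : K => Space N)
            ⟨T, hTK⟩ + earlyWeight lam s r T •
              ContinuousLinearMap.proj (R := ℝ) (φ := fun _ : K => Space N) ⟨s, hsK⟩).comp
            (ContinuousLinearMap.snd ℝ (Space N) (K → Space N))
        else (ContinuousLinearMap.proj (R := ℝ) (φ := fun _ : K => Space N)
          ⟨t, hmem t t.2 h⟩).comp (ContinuousLinearMap.snd ℝ (Space N) (K → Space N)))
    refine h.congr (.of_forall fun ω => ?_)
    ext1 ⟨t, ht⟩
    by_cases htr : t = r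
    · subst htr
      simp [innovation]
    · simp [htr]

/-- The Bernstein process is a Gaussian process. -/
theorem isGaussianProcess [IsProbabilityMeasure P] (hlam : 0 < lam) (hT : 0 < T)
    (hZ : IsMehlerBernstein lam T Z P) : IsGaussianProcess (fun t : Set.Icc (0 : ℝ) T => Z t) P where
  hasGaussianLaw I := by
    set J : Finset ℝ := (I.image Subtype.val).filter fun t => 0 < t ∧ t < T with hJ
    have h := hasGaussianLaw_insert hlam hT hZ J fun t ht => (Finset.mem_filter.1 ht).2
    have hmem : ∀ t ∈ I, (t : ℝ) ∈ insert 0 (insert T J) := by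
      intro t ht
      have := t.2
      rcases eq_or_lt_of_le t.2.1 with h0 | h0
      · simp [← h0]
      rcases eq_or_lt_of_le t.2.2 with h1 | h1
      · simp [h1]
      · refine Finset.mem_insert_of_mem (Finset.mem_insert_of_mem (Finset.mem_filter.2 ⟨?_, h0, h1⟩))
        exact Finset.mem_image_of_mem _ ht
    exact h.map_fun (ContinuousLinearMap.pi fun t : I => ContinuousLinearMap.proj (R := ℝ)
      (φ := fun _ : ↥(insert 0 (insert T J)) => Space N) ⟨t, hmem t t.2⟩)

lemma memLp_two [IsProbabilityMeasure P] (hlam : 0 < lam) (hT : 0 < T)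
    (hZ : IsMehlerBernstein lam T Z P) {t : ℝ} (ht : t ∈ Set.Icc 0 T) (i : Fin N) :
    MemLp (fun ω => Z t ω i) 2 P :=
  ((isGaussianProcess hlam hT hZ).coord.hasGaussianLaw_eval (i, ⟨t, ht⟩)).memLp_two

lemma innovation_moments [IsProbabilityMeasure P] (hlam : 0 < lam) (hT : 0 < T)
    (hZ : IsMehlerBernstein lam T Z P) {s r : ℝ} (hs : 0 ≤ s) (hsr : s < r) (hrT : r < T)
    (i j : Fin N) :
    MemLp (fun ω => innovation lam T Z s r ω i) 2 P ∧
      ∫ ω, innovation lam T Z s r ω i ∂P = 0 ∧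
      cov[fun ω => innovation lam T Z s r ω i, fun ω => innovation lam T Z s r ω j; P] =
        transitionVar lam s r T * if i = j then 1 else 0 := by
  have hv := transitionVar_pos hlam hsr hrT
  have hm := measurable_innovation hT hZ hs hsr hrT
  have hlaw := (innovation_law_and_indep hlam hT hZ hs hsr hrT).1
  have := isGaussian_isoGaussian (N := N) hv
  have hg : HasGaussianLaw (innovation lam T Z s r) P := ⟨by rw [hlaw]; infer_instance⟩
  refine ⟨(hg.map_fun (EuclideanSpace.proj (𝕜 := ℝ) i)).memLp_two, ?_, ?_⟩
  · rw [← integral_coord_isoGaussian hv i, ← hlaw, integral_map hm.aemeasurable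
      (by fun_prop)]
  · rw [← covariance_coord_isoGaussian hv i j, ← hlaw, covariance_map (by fun_prop) (by fun_prop)
      hm.aemeasurable]
    rfl

/-- One step of the computation of covariances. -/
lemma covariance_step [IsProbabilityMeasure P] (hlam : 0 < lam) (hT : 0 < T)
    (hZ : IsMehlerBernstein lam T Z P) {s r : ℝ} (hs : 0 ≤ s) (hsr : s < r) (hrT : r < T)
    {U : Ω → ℝ}
    (hU : MemLp U 2 P) (j : Fin N) :
    cov[U, fun ω => Z r ω j; P] = cov[U, fun ω => innovation lam T Z s r ω j; P] +
      (lateWeight lam s r T * cov[U, fun ω => Z T ω j; P] +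
        earlyWeight lam s r T * cov[U, fun ω => Z s ω j; P]) := by
  have e : (fun ω => Z r ω j) = fun ω => innovation lam T Z s r ω j +
      (lateWeight lam s r T * Z T ω j + earlyWeight lam s r T * Z s ω j) := by
    ext ω
    simp [innovation]
  have hT2 := (memLp_two hlam hT hZ ⟨hT.le, le_rfl⟩ j).const_mul (lateWeight lam s r T)
  have hs2 := (memLp_two hlam hT hZ ⟨hs, (hsr.trans hrT).le⟩ j).const_mul (earlyWeight lam s r T)
  have h1 := covariance_add_right hU (innovation_moments hlam hT hZ hs hsr hrT j j).1 (hT2.add hs2)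
  have h2 := covariance_add_right hU hT2 hs2
  rw [covariance_const_mul_right, covariance_const_mul_right] at h2
  rw [e, ← h2]
  exact h1

lemma covariance_innovation_eq_zero [IsProbabilityMeasure P] (hlam : 0 < lam) (hT : 0 < T)
    (hZ : IsMehlerBernstein lam T Z P) {s r : ℝ} (hs : 0 ≤ s) (hsr : s < r) (hrT : r < T)
    {U : Ω → ℝ}
    (hU : MemLp U 2 P) (mU : Measurable[pastEndSigma T Z s] U) (j : Fin N) :
    cov[U, fun ω => innovation lam T Z s r ω j; P] = 0 := by
  have hind := (innovation_law_and_indep hlam hT hZ hs hsr hrT).2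
  have h : IndepFun (innovation lam T Z s r) U P := indep_of_indep_of_le_right hind mU.comap_le
  have h2 : IndepFun U (fun ω => innovation lam T Z s r ω j) P :=
    (h.comp (EuclideanSpace.proj (𝕜 := ℝ) j).continuous.measurable measurable_id).symm
  exact h2.covariance_eq_zero hU (innovation_moments hlam hT hZ hs hsr hrT j j).1

end IsMehlerBernstein

end BernsteinOU

/-! ### The covariance of the Bernstein process. -/

namespace BernsteinOU

section Algebra

variable {lam : ℝ}

lemma ouCov_eq_sinh (hlam : 0 < lam) {s t : ℝ} (h : s ≤ t) :
    ouCov lam s t = Real.sinh (lam * s) * Real.exp (-(lam * t)) / lam := by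
  rw [ouCov_of_le h, Real.sinh_eq, show -(lam * (t + s)) = -(lam * t) + -(lam * s) by ring,
    show 2 * lam * s = lam * s + lam * s by ring, Real.exp_add, Real.exp_add, Real.exp_neg,
    Real.exp_neg]
  field_simp

/-- As functions of `b`, both sides solve `f'' = f` and they agree at `b = a` and `b = c`. This is
why the Bernstein weights interpolate the exponential factor of `ouCov` exactly. -/
lemma sinh_mul_exp_neg_interpolation (a b c : ℝ) :
    Real.sinh (b - a) * Real.exp (-c) + Real.sinh (c - b) * Real.exp (-a) =
      Real.sinh (c - a) * Real.exp (-b) := by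
  simp only [Real.sinh_eq, neg_sub, Real.exp_sub, Real.exp_neg]
  field_simp
  ring

lemma lateWeight_mul_add_earlyWeight_mul (hlam : 0 < lam) {s r t : ℝ} (hsr : s < r) (hrt : r < t) :
    lateWeight lam s r t * ouCov lam s t + earlyWeight lam s r t * ouCov lam s s =
      ouCov lam s r := by
  have h := sinh_mul_exp_neg_interpolation (lam * s) (lam * r) (lam * t)
  have p := (sinh_mul_sub_pos hlam (hsr.trans hrt)).ne'
  rw [ouCov_eq_sinh hlam (hsr.trans hrt).le, ouCov_eq_sinh hlam le_rfl, ouCov_eq_sinh hlam hsr.le,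
    lateWeight, earlyWeight]
  simp only [← mul_sub] at h
  field_simp
  linear_combination Real.sinh (lam * s) * h

lemma lateWeight_mul_ouCov_end (hlam : 0 < lam) {r t : ℝ} (hr : 0 < r) (hrt : r < t) :
    lateWeight lam 0 r t * ouCov lam t t = ouCov lam r t := by
  have p := (sinh_mul_sub_pos hlam (hr.trans hrt)).ne'
  rw [sub_zero] at p
  rw [ouCov_eq_sinh hlam hrt.le, ouCov_eq_sinh hlam le_rfl, lateWeight, sub_zero, sub_zero]
  field_simp

lemma transitionVar_add_lateWeight_mul (hlam : 0 < lam) {r t : ℝ} (hr : 0 < r) (hrt : r < t) :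
    transitionVar lam 0 r t + lateWeight lam 0 r t * ouCov lam r t = ouCov lam r r := by
  have h := sinh_mul_exp_neg_interpolation 0 (lam * r) (lam * t)
  have p := (sinh_mul_sub_pos hlam (hr.trans hrt)).ne'
  rw [ouCov_eq_sinh hlam hrt.le, ouCov_eq_sinh hlam le_rfl, lateWeight, transitionVar]
  simp only [sub_zero, neg_zero, Real.exp_zero, mul_one, ← mul_sub] at h p ⊢
  field_simp
  linear_combination h

lemma ouCov_zero_left (hlam : 0 < lam) {t : ℝ} (ht : 0 ≤ t) : ouCov lam 0 t = 0 := by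
  simp [ouCov_eq_sinh hlam ht]

end Algebra

variable {N : ℕ} {lam T : ℝ} {Ω : Type*} {Z : ℝ → Ω → Space N} [mΩ : MeasurableSpace Ω]
  {P : Measure Ω}

namespace IsMehlerBernstein

lemma integral_end (hlam : 0 < lam) (hT : 0 < T) (hZ : IsMehlerBernstein lam T Z P) (i : Fin N) :
    ∫ ω, Z T ω i ∂P = 0 := by
  rw [← integral_coord_isoGaussian (ouVar_pos hlam hT) i, ← map_end hlam hT hZ,
    integral_map (hZ.isBernstein.measurable T ⟨hT.le, le_rfl⟩).aemeasurable (by fun_prop)]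

lemma integral_coord [IsProbabilityMeasure P] (hlam : 0 < lam) (hT : 0 < T)
    (hZ : IsMehlerBernstein lam T Z P) {t : ℝ} (ht : t ∈ Set.Icc 0 T) (i : Fin N) :
    ∫ ω, Z t ω i ∂P = 0 := by
  have h0 : ∫ ω, Z 0 ω i ∂P = 0 := integral_eq_zero_of_ae <| by
    filter_upwards [ae_zero hlam hT hZ] with ω hω
    simp [hω]
  rcases eq_or_lt_of_le ht.1 with h | h
  · rw [← h, h0]
  rcases eq_or_lt_of_le ht.2 with h' | h'
  · rw [h', integral_end hlam hT hZ]
  obtain ⟨h1, h2, -⟩ := innovation_moments hlam hT hZ le_rfl h h' i i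
  have e : (fun ω => Z t ω i) = fun ω => innovation lam T Z 0 t ω i +
      (lateWeight lam 0 t T * Z T ω i + earlyWeight lam 0 t T * Z 0 ω i) := by
    ext ω
    simp [innovation]
  have iT := ((memLp_two hlam hT hZ ⟨hT.le, le_rfl⟩ i).integrable one_le_two).const_mul
    (lateWeight lam 0 t T)
  have i0 := ((memLp_two hlam hT hZ ⟨le_rfl, hT.le⟩ i).integrable one_le_two).const_mul
    (earlyWeight lam 0 t T)
  have h3 := integral_add iT i0
  rw [integral_const_mul, integral_const_mul, h0, integral_end hlam hT hZ, mul_zero, mul_zero,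
    add_zero] at h3
  rw [e]
  exact (integral_add (h1.integrable one_le_two) (iT.add i0)).trans
    ((congrArg₂ _ h2 h3).trans (add_zero 0))

lemma covariance_zero (hlam : 0 < lam) (hT : 0 < T)
    (hZ : IsMehlerBernstein lam T Z P) (U : Ω → ℝ) (j : Fin N) :
    cov[U, fun ω => Z 0 ω j; P] = 0 := by
  have h : (fun ω => Z 0 ω j) =ᵐ[P] fun _ => 0 := by
    filter_upwards [ae_zero hlam hT hZ] with ω hω
    simp [hω]
  rw [covariance, integral_congr_ae h]
  refine integral_eq_zero_of_ae ?_
  filter_upwards [h] with ω hω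
  simp [hω]

lemma covariance_end (hlam : 0 < lam) (hT : 0 < T)
    (hZ : IsMehlerBernstein lam T Z P) (i j : Fin N) :
    cov[fun ω => Z T ω i, fun ω => Z T ω j; P] = ouCov lam T T * if i = j then 1 else 0 := by
  have hv := ouVar_pos hlam hT
  rw [← ouVar_eq_ouCov hlam, ← covariance_coord_isoGaussian hv i j, ← map_end hlam hT hZ,
    covariance_map (by fun_prop) (by fun_prop)
      (hZ.isBernstein.measurable T ⟨hT.le, le_rfl⟩).aemeasurable]
  rfl

/-- Decompose `Z r` from time 0: the innovation is independent of `Z T`, the value at 0 vanishes,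
and only the weight of `Z T` remains. -/
lemma covariance_interior_end [IsProbabilityMeasure P] (hlam : 0 < lam) (hT : 0 < T)
    (hZ : IsMehlerBernstein lam T Z P) {r : ℝ} (hr : 0 < r) (hrT : r < T) (i j : Fin N) :
    cov[fun ω => Z T ω i, fun ω => Z r ω j; P] = ouCov lam r T * if i = j then 1 else 0 := by
  have m := memLp_two hlam hT hZ ⟨hT.le, le_rfl⟩ i
  rw [covariance_step hlam hT hZ le_rfl hr hrT m, covariance_zero hlam hT hZ,
    covariance_innovation_eq_zero hlam hT hZ le_rfl hr hrT m
      ((EuclideanSpace.proj (𝕜 := ℝ) i).continuous.measurable.comp measurable_pastEndSigma_end),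
    covariance_end hlam hT hZ, ← lateWeight_mul_ouCov_end hlam hr hrT]
  ring

lemma covariance_interior_self [IsProbabilityMeasure P] (hlam : 0 < lam) (hT : 0 < T)
    (hZ : IsMehlerBernstein lam T Z P) {r : ℝ} (hr : 0 < r) (hrT : r < T) (i j : Fin N) :
    cov[fun ω => Z r ω i, fun ω => Z r ω j; P] = ouCov lam r r * if i = j then 1 else 0 := by
  have m := memLp_two hlam hT hZ ⟨hr.le, hrT.le⟩ i
  have mT := memLp_two hlam hT hZ ⟨hT.le, le_rfl⟩ j
  obtain ⟨m', -, hc⟩ := innovation_moments hlam hT hZ le_rfl hr hrT j i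
  -- Both factors are decomposed in turn: the second yields a covariance with `Z T`, already known,
  -- and one with the innovation; decomposing the first there leaves only the variance of the
  -- innovation.
  rw [covariance_step hlam hT hZ le_rfl hr hrT m, covariance_zero hlam hT hZ,
    covariance_comm (Y := fun ω => Z T ω j), covariance_interior_end hlam hT hZ hr hrT,
    covariance_comm, covariance_step hlam hT hZ le_rfl hr hrT m', covariance_zero hlam hT hZ, hc,
    covariance_comm (Y := fun ω => Z T ω i),
    covariance_innovation_eq_zero hlam hT hZ le_rfl hr hrT
      (memLp_two hlam hT hZ ⟨hT.le, le_rfl⟩ i)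
      ((EuclideanSpace.proj (𝕜 := ℝ) i).continuous.measurable.comp measurable_pastEndSigma_end),
    ← transitionVar_add_lateWeight_mul hlam hr hrT]
  simp only [eq_comm (a := j)]
  ring

lemma covariance_of_le [IsProbabilityMeasure P] (hlam : 0 < lam) (hT : 0 < T)
    (hZ : IsMehlerBernstein lam T Z P) {s t : ℝ} (hs : 0 ≤ s) (hst : s ≤ t) (ht : t ≤ T)
    (i j : Fin N) :
    cov[fun ω => Z s ω i, fun ω => Z t ω j; P] = ouCov lam s t * if i = j then 1 else 0 := by
  rcases hs.eq_or_lt with rfl | hs0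
  · rw [covariance_comm, covariance_zero hlam hT hZ, ouCov_zero_left hlam hst, zero_mul]
  rcases ht.eq_or_lt with rfl | htT
  · rcases hst.eq_or_lt with rfl | hst
    · exact covariance_end hlam hT hZ i j
    · rw [covariance_comm, covariance_interior_end hlam hT hZ hs0 hst]
      simp only [eq_comm (a := j)]
  rcases hst.eq_or_lt with rfl | hst
  · exact covariance_interior_self hlam hT hZ hs0 htT i j
  have m := memLp_two hlam hT hZ ⟨hs, (hst.trans htT).le⟩ i
  -- Decomposing `Z t` from `s` leaves a weighted mean of the covariances of `Z s` with `Z T` and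
  -- with itself, which the interpolation identity evaluates.
  rw [covariance_step hlam hT hZ hs hst htT m, covariance_comm (Y := fun ω => Z T ω j),
    covariance_interior_end hlam hT hZ hs0 (hst.trans htT),
    covariance_interior_self hlam hT hZ hs0 (hst.trans htT),
    covariance_innovation_eq_zero hlam hT hZ hs hst htT m
      ((EuclideanSpace.proj (𝕜 := ℝ) i).continuous.measurable.comp
        (measurable_pastEndSigma ⟨hs, le_rfl⟩)),
    ← lateWeight_mul_add_earlyWeight_mul hlam hst htT]
  simp only [eq_comm (a := j)]
  ring

/-- The covariance of the Bernstein process. -/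
lemma covariance_eq [IsProbabilityMeasure P] (hlam : 0 < lam) (hT : 0 < T)
    (hZ : IsMehlerBernstein lam T Z P) {s t : ℝ} (hs : s ∈ Set.Icc 0 T) (ht : t ∈ Set.Icc 0 T)
    (i j : Fin N) :
    cov[fun ω => Z s ω i, fun ω => Z t ω j; P] = ouCov lam s t * if i = j then 1 else 0 := by
  rcases le_total s t with h | h
  · exact covariance_of_le hlam hT hZ hs.1 h ht.2 i j
  · rw [covariance_comm, covariance_of_le hlam hT hZ ht.1 h hs.2 j i, ouCov_comm]
    simp only [eq_comm (a := j)]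

end IsMehlerBernstein

end BernsteinOU

/-! ### Marginals, Markov property and identification of the law. -/

namespace BernsteinOU

lemma measurable_toLp_pi {N : ℕ} :
    Measurable (fun x : Fin N → ℝ => (WithLp.toLp 2 x : Space N)) :=
  (PiLp.continuous_toLp 2 _).measurable

lemma measurable_coord {N : ℕ} (i : Fin N) : Measurable fun x : Space N => x i :=
  (EuclideanSpace.proj (𝕜 := ℝ) i).continuous.measurable

variable {N : ℕ} {lam T : ℝ} {Ω : Type*} {Z : ℝ → Ω → Space N} [mΩ : MeasurableSpace Ω]
  {P : Measure Ω}

namespace IsMehlerBernstein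

lemma measurable_coordProcess (hZ : IsMehlerBernstein lam T Z P) (p : Fin N × Set.Icc (0 : ℝ) T) :
    Measurable fun ω => Z p.2 ω p.1 :=
  (measurable_coord p.1).comp (hZ.isBernstein.measurable p.2 p.2.2)

/-- The one-dimensional marginals of the Bernstein process. -/
lemma map_eq_isoGaussian [IsProbabilityMeasure P] (hlam : 0 < lam) (hT : 0 < T)
    (hZ : IsMehlerBernstein lam T Z P) {t : ℝ} (ht : t ∈ Set.Ioc 0 T) :
    P.map (Z t) = isoGaussian N (ouVar lam t) := by
  have hv := ouVar_pos hlam ht.1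
  have hti : t ∈ Set.Icc 0 T := ⟨ht.1.le, ht.2⟩
  have := isGaussian_isoGaussian (N := N) hv
  have hid : HasGaussianLaw (fun x : Space N => x) (isoGaussian N (ouVar lam t)) :=
    ⟨by rw [Measure.map_id']; infer_instance⟩
  have hY : IsGaussianProcess (fun (i : Fin N) (x : Space N) => x i)
      (isoGaussian N (ouVar lam t)) :=
    ⟨fun I => hid.map_fun (ContinuousLinearMap.pi fun i : I => EuclideanSpace.proj (i : Fin N))⟩
  have hX : IsGaussianProcess (fun (i : Fin N) ω => Z t ω i) P :=
    (isGaussianProcess hlam hT hZ).coord.comp_right fun i => (i, ⟨t, hti⟩)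
  -- At a fixed time the coordinates are regarded as a Gaussian process indexed by `Fin N`, so
  -- comparing covariances identifies the law of the vector.
  have h := hX.map_eq_of_covariance_eq hY
    (fun i => measurable_coordProcess hZ (i, ⟨t, hti⟩)) measurable_coord
    (integral_coord hlam hT hZ hti) (integral_coord_isoGaussian hv) fun i j => by
      rw [covariance_eq hlam hT hZ hti hti, covariance_coord_isoGaussian hv, ouVar_eq_ouCov hlam]
  have h' := congrArg (Measure.map fun x : Fin N → ℝ => (WithLp.toLp 2 x : Space N)) h
  rw [Measure.map_map measurable_toLp_pi
      (measurable_pi_lambda _ fun i => measurable_coordProcess hZ (i, ⟨t, hti⟩)),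
    Measure.map_map measurable_toLp_pi (measurable_pi_lambda _ measurable_coord)] at h'
  exact h'.trans Measure.map_id

lemma measurable_increment (hZ : IsMehlerBernstein lam T Z P) {s t : ℝ} (hs : s ∈ Set.Icc 0 T)
    (ht : t ∈ Set.Icc 0 T) (c : ℝ) : Measurable fun ω => Z t ω - c • Z s ω := by
  have e : Measurable fun q : Space N × Space N => q.1 - c • q.2 := by fun_prop
  exact e.comp ((hZ.isBernstein.measurable t ht).prodMk (hZ.isBernstein.measurable s hs))

/-- For `τ ≤ s ≤ t`, the later time enters `ouCov` only through an exponential factor, so passing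
from `s` to `t` multiplies it by `e^{-lam (t - s)}`. -/
lemma covariance_increment_eq_zero [IsProbabilityMeasure P] (hlam : 0 < lam) (hT : 0 < T)
    (hZ : IsMehlerBernstein lam T Z P) {τ s t : ℝ} (hτ : 0 ≤ τ) (hτs : τ ≤ s) (hst : s ≤ t)
    (ht : t ≤ T) (i j : Fin N) :
    cov[fun ω => Z t ω i - Real.exp (-(lam * (t - s))) * Z s ω i, fun ω => Z τ ω j; P] = 0 := by
  have mτ : τ ∈ Set.Icc 0 T := ⟨hτ, (hτs.trans hst).trans ht⟩
  have ms : s ∈ Set.Icc 0 T := ⟨hτ.trans hτs, hst.trans ht⟩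
  have mt : t ∈ Set.Icc 0 T := ⟨(hτ.trans hτs).trans hst, ht⟩
  rw [covariance_fun_sub_left (memLp_two hlam hT hZ mt i)
      ((memLp_two hlam hT hZ ms i).const_mul _) (memLp_two hlam hT hZ mτ j),
    covariance_const_mul_left, covariance_eq hlam hT hZ mt mτ, covariance_eq hlam hT hZ ms mτ,
    ouCov_comm, ouCov_eq_sinh hlam (hτs.trans hst), ouCov_comm, ouCov_eq_sinh hlam hτs,
    show -(lam * t) = -(lam * (t - s)) + -(lam * s) by ring, Real.exp_add]
  ring

/-- Past values and increment are linear in one Gaussian process, so vanishing covariances give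
independence from the entire past at once. The argument is carried out on scalar coordinates, from
which both σ-algebras are recovered. -/
lemma indep_pastSigma_increment [IsProbabilityMeasure P] (hlam : 0 < lam) (hT : 0 < T)
    (hZ : IsMehlerBernstein lam T Z P) {s t : ℝ} (hs : 0 ≤ s) (hst : s ≤ t) (ht : t ≤ T) :
    Indep (pastSigma Z s)
      (MeasurableSpace.comap (fun ω => Z t ω - Real.exp (-(lam * (t - s))) • Z s ω) inferInstance)
      P := by
  have hsT : s ∈ Set.Icc 0 T := ⟨hs, hst.trans ht⟩
  have htT : t ∈ Set.Icc 0 T := ⟨hs.trans hst, ht⟩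
  set c := Real.exp (-(lam * (t - s))) with hc
  let past : Fin N × Set.Icc (0 : ℝ) s → Ω → ℝ := fun p ω => Z p.2 ω p.1
  let incr : Fin N → Ω → ℝ := fun i ω => Z t ω i - c * Z s ω i
  have hmem (p : Set.Icc (0 : ℝ) s) : (p : ℝ) ∈ Set.Icc 0 T := ⟨p.2.1, p.2.2.trans hsT.2⟩
  have hjoint : IsGaussianProcess (Sum.elim past incr) P := by
    have hZg := (isGaussianProcess hlam hT hZ).coord
    refine hZg.of_isGaussianProcess fun q => ?_
    rcases q with ⟨j, τ⟩ | i
    · exact ⟨{(j, ⟨τ, hmem τ⟩)}, ContinuousLinearMap.proj ⟨_, Finset.mem_singleton_self _⟩,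
        fun ω => rfl⟩
    · exact ⟨{(i, ⟨t, htT⟩), (i, ⟨s, hsT⟩)},
        ContinuousLinearMap.proj ⟨(i, ⟨t, htT⟩), by simp⟩ -
          c • ContinuousLinearMap.proj ⟨(i, ⟨s, hsT⟩), by simp⟩, fun ω => rfl⟩
  have hpm : ∀ p, Measurable (past p) := fun p =>
    measurable_coordProcess hZ (p.1, ⟨p.2, hmem p.2⟩)
  have him : ∀ i, Measurable (incr i) := fun i =>
    (measurable_coordProcess hZ (i, ⟨t, htT⟩)).sub
      ((measurable_coordProcess hZ (i, ⟨s, hsT⟩)).const_mul c)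
  have hind := hjoint.indepFun_of_covariance_eq_zero (fun p => (hpm p).aemeasurable)
    (fun i => (him i).aemeasurable) fun p i => by
      rw [covariance_comm]
      exact covariance_increment_eq_zero hlam hT hZ p.2.2.1 p.2.2.2 hst ht i p.1
  refine indep_of_indep_of_le_left (indep_of_indep_of_le_right hind ?_) ?_
  · have e : (fun ω => Z t ω - c • Z s ω) =
        (fun x : Fin N → ℝ => (WithLp.toLp 2 x : Space N)) ∘ fun ω i => incr i ω := by
      ext ω i
      simp [incr]
    rw [e]
    exact (measurable_toLp_pi.comp (comap_measurable _)).comap_le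
  · refine iSup₂_le fun τ hτ => ?_
    have e : Z τ = (fun x : Fin N × Set.Icc (0 : ℝ) s → ℝ =>
        (WithLp.toLp 2 fun i => x (i, ⟨τ, hτ⟩) : Space N)) ∘ fun ω p => past p ω := rfl
    rw [e]
    exact ((measurable_toLp_pi.comp (measurable_pi_lambda _ fun i => measurable_pi_apply _)).comp
      (comap_measurable _)).comap_le

/-- The Bernstein process is a Markov process. -/
theorem isMarkovian [IsProbabilityMeasure P] (hlam : 0 < lam) (hT : 0 < T)
    (hZ : IsMehlerBernstein lam T Z P) : IsMarkovian T Z P where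
  measurable := hZ.isBernstein.measurable
  condExp_eq f hf := by
    rintro ⟨C, hC⟩ s t hs hst ht
    have hm := hZ.isBernstein.measurable
    have hsT : s ∈ Set.Icc 0 T := ⟨hs, hst.trans ht⟩
    set c := Real.exp (-(lam * (t - s))) with hc
    have hind := indep_pastSigma_increment hlam hT hZ hs hst ht
    rw [← hc] at hind
    have hξ := measurable_increment hZ hsT ⟨hs.trans hst, ht⟩ c
    have hf' : Measurable fun q : Space N × Space N => f (c • q.1 + q.2) :=
      hf.comp (by fun_prop)
    have hle : sigmaAt Z s ≤ pastSigma Z s := (measurable_pastSigma ⟨hs, le_rfl⟩).comap_le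
    -- Writing `Z t = c • Z s + increment`, the same freezing formula holds given the whole past and
    -- given `Z s` alone; both produce the same function of `Z s`.
    have h1 := condExp_comp_prod_eq_of_indep (pastSigma_le hm hsT.2)
      (measurable_pastSigma (Z := Z) ⟨hs, le_rfl⟩) hξ hind hf' fun q => hC _
    have h2 := condExp_comp_prod_eq_of_indep (hm s hsT).comap_le (comap_measurable (Z s)) hξ
      (indep_of_indep_of_le_left hind hle) hf' fun q => hC _
    simp only [add_sub_cancel] at h1 h2
    exact h1.trans h2.symm

lemma integrable_mul_and_integral_mul [IsProbabilityMeasure P] (hlam : 0 < lam) (hT : 0 < T)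
    (hZ : IsMehlerBernstein lam T Z P) {s t : ℝ} (hs : s ∈ Set.Icc 0 T) (ht : t ∈ Set.Icc 0 T)
    (i j : Fin N) : Integrable (fun ω => Z s ω i * Z t ω j) P ∧
      ∫ ω, Z s ω i * Z t ω j ∂P = ouCov lam s t * if i = j then 1 else 0 := by
  have h1 := memLp_two hlam hT hZ hs i
  have h2 := memLp_two hlam hT hZ ht j
  refine ⟨h1.integrable_mul h2, ?_⟩
  rw [← covariance_eq hlam hT hZ hs ht, covariance_eq_sub h1 h2, integral_coord hlam hT hZ hs,
    zero_mul, sub_zero]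
  rfl

/-- The Bernstein process has the law of any centered Gaussian process with the same covariance. -/
lemma identDistrib [IsProbabilityMeasure P] (hlam : 0 < lam) (hT : 0 < T)
    (hZ : IsMehlerBernstein lam T Z P) {Ω' : Type*} [MeasurableSpace Ω'] {P' : Measure Ω'}
    {X : ℝ → Ω' → Space N} (mX : ∀ t, Measurable (X t))
    (hX : IsGaussianProcess (fun (p : Fin N × ℝ) ω => X p.2 ω p.1) P')
    (hX0 : ∀ i t, ∫ ω, X t ω i ∂P' = 0)
    (hcov : ∀ i j s t, 0 ≤ s → 0 ≤ t → cov[fun ω => X s ω i, fun ω => X t ω j; P'] =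
      ouCov lam s t * if i = j then 1 else 0) :
    IdentDistrib (fun ω (t : Set.Icc (0 : ℝ) T) => Z t ω)
      (fun ω (t : Set.Icc (0 : ℝ) T) => X t ω) P P' := by
  have hY : IsGaussianProcess (fun (p : Fin N × Set.Icc (0 : ℝ) T) ω => X p.2 ω p.1) P' :=
    hX.comp_right fun p : Fin N × Set.Icc (0 : ℝ) T => (p.1, (p.2 : ℝ))
  have mZ := measurable_coordProcess hZ
  have mY (p : Fin N × Set.Icc (0 : ℝ) T) : Measurable fun ω => X p.2 ω p.1 :=
    (measurable_coord p.1).comp (mX p.2)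
  have hZg := (isGaussianProcess hlam hT hZ).coord
  have h := hZg.map_eq_of_covariance_eq hY mZ mY
    (fun p => integral_coord hlam hT hZ p.2.2 p.1)
    (fun p => hX0 p.1 p.2) fun p q => by
      rw [covariance_eq hlam hT hZ p.2.2 q.2.2, hcov _ _ _ _ p.2.2.1 q.2.2.1]
  have hΦ : Measurable fun (x : Fin N × Set.Icc (0 : ℝ) T → ℝ) (t : Set.Icc (0 : ℝ) T) =>
      (WithLp.toLp 2 fun i => x (i, t) : Space N) :=
    measurable_pi_lambda _ fun t =>
      measurable_toLp_pi.comp (measurable_pi_lambda _ fun i => measurable_pi_apply _)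
  exact IdentDistrib.comp ⟨(measurable_pi_lambda _ mZ).aemeasurable,
    (measurable_pi_lambda _ mY).aemeasurable, h⟩ hΦ

end IsMehlerBernstein

end BernsteinOU

theorem proposition2 (N : ℕ) (hN : 1 ≤ N) (lam T : ℝ) (hlam : 0 < lam) (hT : 0 < T)
    {Ω : Type*} [MeasurableSpace Ω] (P : Measure Ω) [IsProbabilityMeasure P]
    (Z : ℝ → Ω → BernsteinOU.Space N)
    (hZ : BernsteinOU.IsAssociatedBernstein (BernsteinOU.mehlerKernel N lam) T
      (BernsteinOU.diracDatum N lam T) (BernsteinOU.gaussianDatum N lam T) Z P) :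
    -- the process is Gaussian and Markovian
    IsGaussianProcess (fun t : Set.Icc (0 : ℝ) T => Z t) P ∧
    BernsteinOU.IsMarkovian T Z P ∧
    -- its one-dimensional marginals
    (∀ t ∈ Set.Ioc (0 : ℝ) T, ∀ A : Set (BernsteinOU.Space N), MeasurableSet A →
      P.real (Z t ⁻¹' A) =
        (2 * Real.pi * (Real.sinh (lam * t) * Real.exp (-(lam * t)) / lam)) ^ (-((N : ℝ) / 2)) *
          ∫ x in A, Real.exp
            (-(‖x‖ ^ 2 / (2 * (Real.sinh (lam * t) * Real.exp (-(lam * t)) / lam))))) ∧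
    -- it starts at the origin
    P {ω | Z 0 ω = 0} = 1 ∧
    -- its covariance
    (∀ s ∈ Set.Icc (0 : ℝ) T, ∀ t ∈ Set.Icc (0 : ℝ) T, ∀ i j : Fin N,
      Integrable (fun ω => Z s ω i * Z t ω j) P ∧
      ∫ ω, Z s ω i * Z t ω j ∂P =
        Real.exp (-(lam * (t + s))) / (2 * lam) * (Real.exp (2 * lam * min t s) - 1) *
          (if i = j then 1 else 0)) ∧
    -- it has the law of a process whose components are independent, non-stationary
    -- Ornstein-Uhlenbeck processes started at the origin
    (∃ (Ω' : Type) (_ : MeasurableSpace Ω') (P' : Measure Ω') (X : ℝ → Ω' → BernsteinOU.Space N),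
      IsProbabilityMeasure P' ∧
      (∀ t ∈ Set.Icc (0 : ℝ) T, Measurable (X t)) ∧
      iIndepFun (fun (i : Fin N) (ω : Ω') (t : Set.Icc (0 : ℝ) T) => X t ω i) P' ∧
      (∀ i : Fin N,
        BernsteinOU.IsOrnsteinUhlenbeckFromZero lam T (fun t ω => X t ω i) P' ∧
        ¬ BernsteinOU.IsStationaryOn T (fun t ω => X t ω i) P') ∧
      IdentDistrib (fun ω (t : Set.Icc (0 : ℝ) T) => Z t ω)
        (fun ω (t : Set.Icc (0 : ℝ) T) => X t ω) P P') := by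

  have hZ' : BernsteinOU.IsMehlerBernstein lam T Z P := hZ
  refine ⟨hZ'.isGaussianProcess hlam hT, hZ'.isMarkovian hlam hT, fun t ht A hA => ?_, ?_,
    fun s hs t ht i j => hZ'.integrable_mul_and_integral_mul hlam hT hs ht i j, ?_⟩
  · rw [← map_measureReal_apply (hZ.isBernstein.measurable t ⟨ht.1.le, ht.2⟩) hA,
      hZ'.map_eq_isoGaussian hlam hT ht,
      BernsteinOU.isoGaussian_real_apply (BernsteinOU.ouVar_pos hlam ht.1) hA]
    exact integral_const_mul _ _
  · exact (mem_ae_iff_prob_eq_one ((hZ.isBernstein.measurable 0 ⟨le_rfl, hT.le⟩)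
      (measurableSet_singleton 0))).1 (hZ'.ae_zero hlam hT)
  · obtain ⟨Ω', mΩ', P', X, hP', mX, hind, hOU, hX, hX0, hcov⟩ :=
      BernsteinOU.exists_ornsteinUhlenbeck N hlam hT
    refine ⟨Ω', mΩ', P', X, hP', fun t _ => mX t, ?_, hOU,
      hZ'.identDistrib hlam hT mX hX hX0 hcov⟩
    exact hind.comp (fun _ (x : ℝ → ℝ) (t : Set.Icc (0 : ℝ) T) => x t) fun _ =>
      measurable_pi_lambda _ fun t => measurable_pi_apply _
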